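/- Let $k\in\{0,1\}$, $b\in(0,\infty]$, let $a:(0,b)\to(0,\infty)$ be smooth, and let $M=(0,b)\times\mathbb R^3$ with Cartesian coordinates $(t,x,y,z)$ carry the Friedmann-Robertson-Walker metric $g=-dt^2+a(t)^2f(r)^2(dx^2+dy^2+dz^2)$, where $f(r)=(1+kr^2/4)^{-1}$ and $r^2=x^2+y^2+z^2$. (For $k=1$ this is $(0,b)\times S^3$ in stereographic coordinates, with the one point $r=\infty$ of the unit sphere $S^3$ left out.) On $T^*M$, with its canonical symplectic form, let $H(x,p)=\tfrac12 g^{\mu\nu}p_\mu p_\nu$. For a vector field $X$ on $M$ write $\hat X(x,p)=p(X(x))$. Let $\xi_1=y\partial_z-z\partial_y$, $\xi_2=z\partial_x-x\partial_z$, $\xi_3=x\partial_y-y\partial_x$ and $\eta_i=(1-\tfrac k4r^2)\partial_{x^i}+\tfrac k2x^i\sum_j x^j\partial_{x^j}$ $(i=1,2,3)$, with $(x^1,x^2,x^3)=(x,y,z)$, be the spatial Killing fields, and put $L^2=\sum_i\hat\xi_i^2$, $K^2=\sum_i\hat\eta_i^2$ and $$F_1=2H,\qquad F_2=L^2,\qquad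 F_3=\hat\xi_3,\qquad F_4=K^2+kL^2 .$$ Let $m,\lambda,a_\theta>0$ and $a_\phi\in\mathbb R$ with $a_\phi^2<a_\theta^2$, and if $k=1$ assume also $\lambda^2>a_\theta^2$. Let $$\Gamma=\{(x,p)\in T^*M:\ F_1=-m^2,\ F_2=a_\theta^2,\ F_3=a_\phi,\ F_4=\lambda^2\}.$$ Then $\Gamma$ is non-empty, $dF_1,\dots,dF_4$ are linearly independent at every point of $\Gamma$, and $\Gamma$ is a smooth embedded four-dimensional submanifold of $T^*M$ that is invariant under the (local) Hamiltonian flows of $H$ and of $F_1,\dots,F_4$. It has exactly two connected components, $\Gamma\cap\{p_t>0\}$ and $\Gamma\cap\{p_t<0\}$. If $k=0$, each component is homeomorphic to $\mathbb R\times\mathbb R\times S^1\times S^1$. If $k=1$, each component is homeomorphic to $\mathbb R\times S^1\times S^1\times S^1$, and the set of values of $r$ on it is exactly $[r_-,r_+]$, where $r_\pm=2\bigl(\hat a\pm\sqrt{\hat a^2-1}\bigr)$ and $\hat a=\lambda/a_\theta$; moreover the cotangent lift of inverse stereographic projection maps $\Gamma$ bijectively onto the level set, with the same values, of the corresponding integrals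 on all of $T^*((0,b)\times S^3)$, so that no point of the level set is missed by the Cartesian coordinates. -/

import Mathlib

open scoped ContDiff

noncomputable section

namespace FRW

/-- A point `(x, p)` of phase space, in the global Cartesian coordinates
`x = (t, x, y, z)` and the adapted momenta `p = (p_t, p_x, p_y, p_z)`. -/
abbrev Phase : Type := (Fin 4 → ℝ) × (Fin 4 → ℝ)

/-- The range `(0, b)` of the time coordinate, where `b = ∞` is allowed. -/
def timeInterval (b : EReal) : Set ℝ := {t | 0 < t ∧ (t : EReal) < b}

/-- The cotangent bundle of `M = (0, b) × ℝ³`. -/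
def cotangentBundle (b : EReal) : Set Phase := {z | z.1 0 ∈ timeInterval b}

/-- `r² = x² + y² + z²`. -/
def rsq (x : Fin 4 → ℝ) : ℝ := x 1 ^ 2 + x 2 ^ 2 + x 3 ^ 2

/-- The radial coordinate of the base point. -/
def radius (z : Phase) : ℝ := Real.sqrt (rsq z.1)

/-- The conformal factor `f(r) = (1 + k r² / 4)⁻¹`. -/
def conf (k : ℝ) (x : Fin 4 → ℝ) : ℝ := (1 + k * rsq x / 4)⁻¹

/-- The diagonal components of the (diagonal) metric
`g = -dt² + a(t)² f(r)² (dx² + dy² + dz²)`. -/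
def metricDiag (k : ℝ) (a : ℝ → ℝ) (x : Fin 4 → ℝ) : Fin 4 → ℝ :=
  ![-1, a (x 0) ^ 2 * conf k x ^ 2, a (x 0) ^ 2 * conf k x ^ 2, a (x 0) ^ 2 * conf k x ^ 2]

/-- The geodesic Hamiltonian `H(x, p) = ½ g^{μν}(x) p_μ p_ν`. -/
def hamiltonian (k : ℝ) (a : ℝ → ℝ) (z : Phase) : ℝ :=
  1 / 2 * ∑ μ, (metricDiag k a z.1 μ)⁻¹ * z.2 μ ^ 2

/-- The rotational Killing fields `y ∂_z - z ∂_y`, `z ∂_x - x ∂_z`, `x ∂_y - y ∂_x`. -/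
def xi : Fin 3 → (Fin 4 → ℝ) → (Fin 4 → ℝ) :=
  ![fun x => ![0, 0, -x 3, x 2],
    fun x => ![0, x 3, 0, -x 1],
    fun x => ![0, -x 2, x 1, 0]]

/-- The remaining three spatial Killing fields (the translations if `k = 0`). -/
def eta (k : ℝ) : Fin 3 → (Fin 4 → ℝ) → (Fin 4 → ℝ) :=
  ![fun x => ![0, 1 + k / 4 * (x 1 ^ 2 - x 2 ^ 2 - x 3 ^ 2),
      k / 2 * x 1 * x 2, k / 2 * x 1 * x 3],
    fun x => ![0, k / 2 * x 1 * x 2,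
      1 - k / 4 * (x 1 ^ 2 - x 2 ^ 2 + x 3 ^ 2), k / 2 * x 2 * x 3],
    fun x => ![0, k / 2 * x 1 * x 3, k / 2 * x 2 * x 3,
      1 - k / 4 * (x 1 ^ 2 + x 2 ^ 2 - x 3 ^ 2)]]

/-- The function `(x, p) ↦ p(X(x))` on the cotangent bundle induced by a vector field `X`. -/
def hat (X : (Fin 4 → ℝ) → (Fin 4 → ℝ)) (z : Phase) : ℝ := ∑ μ, X z.1 μ * z.2 μ

/-- `L² = ∑ᵢ ξ̂ᵢ²`. -/
def Lsq (z : Phase) : ℝ := ∑ i, hat (xi i) z ^ 2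

/-- `K² = ∑ᵢ η̂ᵢ²`. -/
def Ksq (k : ℝ) (z : Phase) : ℝ := ∑ i, hat (eta k i) z ^ 2

/-- The integrals `F₁ = 2H`, `F₂ = L²`, `F₃ = L₃`, `F₄ = K² + k L²`. -/
def F (k : ℝ) (a : ℝ → ℝ) : Fin 4 → Phase → ℝ :=
  ![fun z => 2 * hamiltonian k a z,
    Lsq,
    hat (xi 2),
    fun z => Ksq k z + k * Lsq z]

/-- The common level set `F₁ = -m²`, `F₂ = a_θ²`, `F₃ = a_φ`, `F₄ = λ²` in the cotangent bundle. -/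
def levelSet (k : ℝ) (b : EReal) (a : ℝ → ℝ) (m lam aθ aφ : ℝ) : Set Phase :=
  {z | z ∈ cotangentBundle b ∧ F k a 0 z = -m ^ 2 ∧ F k a 1 z = aθ ^ 2 ∧
    F k a 2 z = aφ ∧ F k a 3 z = lam ^ 2}

/-- The symplectic form `Ω = dp_μ ∧ dx^μ`. -/
def Omega (u v : Phase) : ℝ := ∑ μ, (u.2 μ * v.1 μ - v.2 μ * u.1 μ)

/-- The Hamiltonian vector field of `G`: `∂G/∂p_μ ∂/∂x^μ - ∂G/∂x^μ ∂/∂p_μ`. -/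
def hamVec (G : Phase → ℝ) (z : Phase) : Phase :=
  (fun μ => fderiv ℝ G z (0, Pi.single μ 1), fun μ => -fderiv ℝ G z (Pi.single μ 1, 0))

/-- The vector field `hamVec G` is the one determined by `dG = Ω(·, X_G)`. -/
theorem Omega_hamVec (G : Phase → ℝ) (z v : Phase) : Omega v (hamVec G z) = fderiv ℝ G z v := by
  have hv : v = ∑ μ, (v.1 μ • ((Pi.single μ 1, 0) : Phase) + v.2 μ • ((0, Pi.single μ 1) : Phase)) := by
    refine Prod.ext ?_ ?_ <;> ext ν <;> fin_cases ν <;>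
      simp [Fin.sum_univ_four]
  conv_rhs => rw [hv]
  simp only [map_sum, map_add, map_smul, smul_eq_mul, Omega, hamVec]
  exact Finset.sum_congr rfl fun μ _ => by ring

/-- `S` is invariant under the (local) Hamiltonian flow of `G` on the cotangent bundle: an integral
curve of `hamVec G`, defined on an arbitrary interval `J`, that meets `S` stays in `S`. -/
def IsInvariant (b : EReal) (G : Phase → ℝ) (S : Set Phase) : Prop :=
  ∀ (J : Set ℝ) (γ : ℝ → Phase), J.OrdConnected →
    (∀ s ∈ J, γ s ∈ cotangentBundle b) →
    (∀ s ∈ J, HasDerivWithinAt γ (hamVec G (γ s)) J s) →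
    ∀ s₀ ∈ J, γ s₀ ∈ S → ∀ s ∈ J, γ s ∈ S

/-- `S` is an (embedded) smooth four-dimensional submanifold of the eight-dimensional phase space:
near each of its points there is a smooth chart in which `S` is the slice on which the last four
coordinates vanish. -/
def IsSmoothSubmanifold (S : Set Phase) : Prop :=
  ∀ z ∈ S, ∃ ψ : OpenPartialHomeomorph Phase ((Fin 4 → ℝ) × (Fin 4 → ℝ)),
    z ∈ ψ.source ∧ ContDiffOn ℝ ∞ ψ ψ.source ∧ ContDiffOn ℝ ∞ ψ.symm ψ.target ∧
    ∀ w ∈ ψ.source, w ∈ S ↔ (ψ w).2 = 0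

/-- `r_- = (2/k) (â - √(â² - k))` with `â = λ / a_θ`. -/
def rMinus (k lam aθ : ℝ) : ℝ := 2 / k * (lam / aθ - Real.sqrt ((lam / aθ) ^ 2 - k))

/-- `r_+ = (2/k) (â + √(â² - k))` with `â = λ / a_θ`. -/
def rPlus (k lam aθ : ℝ) : ℝ := 2 / k * (lam / aθ + Real.sqrt ((lam / aθ) ^ 2 - k))

/-- For `k = 1` the Cartesian coordinates are stereographic coordinates on the unit sphere `S³`
(the point `r = ∞` being left out). A point `(t, y, p_t, q)` of the cotangent bundle of
`(0, b) × S³` is written with `y ∈ ℝ⁴`, `|y| = 1`, and `q ∈ ℝ⁴`, `y · q = 0`, where `q` stands for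
the covector `v ↦ q · v` on the tangent space of `S³` at `y`. -/
abbrev SpherePhase : Type := (ℝ × (Fin 4 → ℝ)) × (ℝ × (Fin 4 → ℝ))

/-- The cotangent lift of inverse stereographic projection: `y = (f x, f (1 - r²/4))`, and `q` is
the vector tangent to the sphere at `y` with `∑ q_j dy_j = p_x dx + p_y dy + p_z dz`. -/
def toSphere (z : Phase) : SpherePhase :=
  ((z.1 0, ![conf 1 z.1 * z.1 1, conf 1 z.1 * z.1 2, conf 1 z.1 * z.1 3,
      conf 1 z.1 * (1 - rsq z.1 / 4)]),
   (z.2 0, ![z.2 1 / conf 1 z.1 - z.1 1 * (z.1 1 * z.2 1 + z.1 2 * z.2 2 + z.1 3 * z.2 3) / 2,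
      z.2 2 / conf 1 z.1 - z.1 2 * (z.1 1 * z.2 1 + z.1 2 * z.2 2 + z.1 3 * z.2 3) / 2,
      z.2 3 / conf 1 z.1 - z.1 3 * (z.1 1 * z.2 1 + z.1 2 * z.2 2 + z.1 3 * z.2 3) / 2,
      -(z.1 1 * z.2 1 + z.1 2 * z.2 2 + z.1 3 * z.2 3)]))

/-- The value on the covector `q` at `y ∈ S³` of the Killing field `y_i ∂_j - y_j ∂_i`. -/
def rot (w : SpherePhase) (i j : Fin 4) : ℝ := w.1.2 i * w.2.2 j - w.1.2 j * w.2.2 i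

/-- The common level set of the same integrals on the full cotangent bundle of `(0, b) × S³` with
the metric `-dt² + a(t)² g_{S³}`: here `2H = -p_t² + |q|² / a²`, the rotational Killing fields are
`y_i ∂_j - y_j ∂_i` with `i, j ≤ 3`, and the `η_i` are `y_4 ∂_i - y_i ∂_4` (indices from `1`). -/
def sphereLevelSet (b : EReal) (a : ℝ → ℝ) (m lam aθ aφ : ℝ) : Set SpherePhase :=
  {w | w.1.1 ∈ timeInterval b ∧ ∑ j, w.1.2 j ^ 2 = 1 ∧ ∑ j, w.1.2 j * w.2.2 j = 0 ∧
    -w.2.1 ^ 2 + (∑ j, w.2.2 j ^ 2) / a w.1.1 ^ 2 = -m ^ 2 ∧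
    rot w 1 2 ^ 2 + rot w 2 0 ^ 2 + rot w 0 1 ^ 2 = aθ ^ 2 ∧
    rot w 0 1 = aφ ∧
    (rot w 3 0 ^ 2 + rot w 3 1 ^ 2 + rot w 3 2 ^ 2) +
      (rot w 1 2 ^ 2 + rot w 2 0 ^ 2 + rot w 0 1 ^ 2) = lam ^ 2}

end FRW

end

open scoped ContDiff

noncomputable section

namespace FRW

/-! Everything rests on two identities. Since `K² = (1 - k r²/4)² |p|² + k (x·p)²` and `L² = r² |p|²
- (x·p)²`, the integral `K² + k L²` collapses to `(1 + k r²/4)² |p|²`, so `2H = -p_t² + a⁻² F₄`. On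
the level set the mass condition then says `p_t² = m² + λ²/a(t)²`: `t` is free, and `p_t` is
determined up to a sign and never vanishes.

The spatial part is motion in the plane orthogonal to the fixed-length vector `L = x × p`. Its third
component is fixed with `|a_φ| < a_θ`, so the horizontal part of `L` has constant length `ρ > 0` and
only its direction `u` is free. The direction `v` of `x` in the plane orthogonal to `L` is a second
circle. What remains is the pair `(r, D) = (r, x·p)`, bound by `(D² + a_θ²)(1 + k r²/4)² = r² λ²`.
This curve is a branch of a hyperbola for `k = 0`; for `k = 1`, writing `cos χ = (1 - r²/4)/(1 +
r²/4)` turns it into the ellipse `D² + λ² cos² χ = λ² - a_θ²`. Hence each sign of `p_t` gives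
(interval) × circle × circle × (radial curve), by explicit mutually inverse continuous maps
(`branchHomeomorph`). These products are connected, so they are the components.

Independence of the differentials is tested on chosen tangent vectors (`linearIndependent_fderiv_F`)
and yields the submanifold through the inverse function theorem; invariance is the vanishing of all
Poisson brackets (`fderiv_F_hamVec_F`). For `k = 1`, stereographic projection matches the integrals
with those on the sphere, and the omitted pole has `L = 0`, which `a_θ > 0` excludes. -/

/-! ### The integrals in coordinates. -/

/-- The conserved quantity `|p|² / f(r)²`, to which `K² + k L²` simplifies. -/
def spatialEnergy (k : ℝ) (z : Phase) : ℝ :=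
  (1 + k * rsq z.1 / 4) ^ 2 * (z.2 1 ^ 2 + z.2 2 ^ 2 + z.2 3 ^ 2)

theorem hat_xi_two (z : Phase) : hat (xi 2) z = z.1 1 * z.2 2 - z.1 2 * z.2 1 := by
  simp [hat, xi, Fin.sum_univ_four]; ring

theorem Lsq_apply (z : Phase) :
    Lsq z = (z.1 2 * z.2 3 - z.1 3 * z.2 2) ^ 2 + (z.1 3 * z.2 1 - z.1 1 * z.2 3) ^ 2 +
      (z.1 1 * z.2 2 - z.1 2 * z.2 1) ^ 2 := by
  simp [Lsq, hat, xi, Fin.sum_univ_four, Fin.sum_univ_three]; ring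

/-- With `D = x·p`, `K²` expands to `(1 - k r²/4)² |p|² + k D²` and `k L²` to `k r² |p|² - k D²`;
the `D²` terms cancel and the rest is a perfect square times `|p|²`. -/
theorem Ksq_add (k : ℝ) (z : Phase) : Ksq k z + k * Lsq z = spatialEnergy k z := by
  simp only [Lsq_apply, Ksq, hat, eta, Fin.sum_univ_four, Fin.sum_univ_three, spatialEnergy, rsq,
    Matrix.cons_val]
  ring

theorem two_mul_hamiltonian (k : ℝ) (a : ℝ → ℝ) (z : Phase) :
    2 * hamiltonian k a z = -z.2 0 ^ 2 + (a (z.1 0) ^ 2)⁻¹ * spatialEnergy k z := by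
  simp only [hamiltonian, metricDiag, conf, Fin.sum_univ_four, Matrix.cons_val, spatialEnergy,
    mul_inv, inv_pow, inv_inv]
  norm_num
  ring

theorem F_zero (k : ℝ) (a : ℝ → ℝ) :
    F k a 0 = fun z => -z.2 0 ^ 2 + (a (z.1 0) ^ 2)⁻¹ * spatialEnergy k z :=
  funext fun z => two_mul_hamiltonian k a z

theorem F_one (k : ℝ) (a : ℝ → ℝ) : F k a 1 = fun z : Phase =>
    (z.1 2 * z.2 3 - z.1 3 * z.2 2) ^ 2 + (z.1 3 * z.2 1 - z.1 1 * z.2 3) ^ 2 +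
      (z.1 1 * z.2 2 - z.1 2 * z.2 1) ^ 2 :=
  funext Lsq_apply

theorem F_two (k : ℝ) (a : ℝ → ℝ) :
    F k a 2 = fun z : Phase => z.1 1 * z.2 2 - z.1 2 * z.2 1 :=
  funext hat_xi_two

theorem F_three (k : ℝ) (a : ℝ → ℝ) : F k a 3 = spatialEnergy k :=
  funext fun z => Ksq_add k z

theorem mem_levelSet {k : ℝ} {b : EReal} {a : ℝ → ℝ} {m lam aθ aφ : ℝ} {z : Phase} :
    z ∈ levelSet k b a m lam aθ aφ ↔ z.1 0 ∈ timeInterval b ∧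
      z.2 0 ^ 2 = m ^ 2 + (a (z.1 0) ^ 2)⁻¹ * lam ^ 2 ∧
      (z.1 2 * z.2 3 - z.1 3 * z.2 2) ^ 2 + (z.1 3 * z.2 1 - z.1 1 * z.2 3) ^ 2 +
        (z.1 1 * z.2 2 - z.1 2 * z.2 1) ^ 2 = aθ ^ 2 ∧
      z.1 1 * z.2 2 - z.1 2 * z.2 1 = aφ ∧ spatialEnergy k z = lam ^ 2 := by
  simp only [levelSet, Set.mem_ofPred_eq, F_zero, F_one, F_two, F_three, cotangentBundle]
  constructor
  · rintro ⟨h0, h1, h2, h3, h4⟩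
    rw [h4] at h1
    exact ⟨h0, by linarith, h2, h3, h4⟩
  · rintro ⟨h0, h1, h2, h3, h4⟩
    refine ⟨h0, ?_, h2, h3, h4⟩
    rw [h4]; linarith

theorem isOpen_timeInterval (b : EReal) : IsOpen (timeInterval b) :=
  (isOpen_lt continuous_const continuous_id).inter
    (isOpen_lt continuous_coe_real_ereal continuous_const)

theorem isOpen_cotangentBundle (b : EReal) : IsOpen (cotangentBundle b) :=
  (isOpen_timeInterval b).preimage (by fun_prop)

theorem contDiff_spatialEnergy (k : ℝ) : ContDiff ℝ ∞ (spatialEnergy k) := by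
  unfold spatialEnergy rsq; fun_prop

theorem contDiffOn_F {k : ℝ} {b : EReal} {a : ℝ → ℝ} (ha : ContDiffOn ℝ ∞ a (timeInterval b))
    (ha_pos : ∀ t ∈ timeInterval b, 0 < a t) (i : Fin 4) :
    ContDiffOn ℝ ∞ (F k a i) (cotangentBundle b) := by
  fin_cases i
  · change ContDiffOn ℝ ∞ (F k a 0) _
    rw [F_zero]
    have h : ContDiffOn ℝ ∞ (fun z : Phase => a (z.1 0)) (cotangentBundle b) :=
      ha.comp (t := timeInterval b) (f := fun z : Phase => z.1 0) (by fun_prop) fun z hz => hz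
    have h' : ContDiffOn ℝ ∞ (fun z : Phase => (a (z.1 0) ^ 2)⁻¹) (cotangentBundle b) :=
      (h.pow 2).inv fun z hz => (pow_pos (ha_pos _ hz) 2).ne'
    exact ContDiffOn.add (by fun_prop) (h'.mul (contDiff_spatialEnergy k).contDiffOn)
  · change ContDiffOn ℝ ∞ (F k a 1) _
    rw [F_one]; fun_prop
  · change ContDiffOn ℝ ∞ (F k a 2) _
    rw [F_two]; fun_prop
  · change ContDiffOn ℝ ∞ (F k a 3) _
    rw [F_three]; exact (contDiff_spatialEnergy k).contDiffOn

/-! ### Differentials, Poisson brackets and invariance. -/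

theorem hasFDerivAt_position (i : Fin 4) (z : Phase) :
    HasFDerivAt (fun w : Phase => w.1 i)
      ((ContinuousLinearMap.proj i).comp (ContinuousLinearMap.fst ℝ (Fin 4 → ℝ) (Fin 4 → ℝ))) z :=
  ((ContinuousLinearMap.proj (R := ℝ) (φ := fun _ : Fin 4 => ℝ) i).comp
    (ContinuousLinearMap.fst ℝ (Fin 4 → ℝ) (Fin 4 → ℝ))).hasFDerivAt

theorem hasFDerivAt_momentum (i : Fin 4) (z : Phase) :
    HasFDerivAt (fun w : Phase => w.2 i)
      ((ContinuousLinearMap.proj i).comp (ContinuousLinearMap.snd ℝ (Fin 4 → ℝ) (Fin 4 → ℝ))) z :=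
  ((ContinuousLinearMap.proj (R := ℝ) (φ := fun _ : Fin 4 => ℝ) i).comp
    (ContinuousLinearMap.snd ℝ (Fin 4 → ℝ) (Fin 4 → ℝ))).hasFDerivAt

theorem fderiv_F_one (k : ℝ) (a : ℝ → ℝ) (z v : Phase) : fderiv ℝ (F k a 1) z v =
    2 * (z.1 2 * z.2 3 - z.1 3 * z.2 2) *
        (v.1 2 * z.2 3 + z.1 2 * v.2 3 - v.1 3 * z.2 2 - z.1 3 * v.2 2) +
      2 * (z.1 3 * z.2 1 - z.1 1 * z.2 3) *
        (v.1 3 * z.2 1 + z.1 3 * v.2 1 - v.1 1 * z.2 3 - z.1 1 * v.2 3) +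
      2 * (z.1 1 * z.2 2 - z.1 2 * z.2 1) *
        (v.1 1 * z.2 2 + z.1 1 * v.2 2 - v.1 2 * z.2 1 - z.1 2 * v.2 1) := by
  have L (i j : Fin 4) := HasFDerivAt.pow (((hasFDerivAt_position i z).fun_mul (hasFDerivAt_momentum j z)).fun_sub
    ((hasFDerivAt_position j z).fun_mul (hasFDerivAt_momentum i z))) 2
  rw [F_one, (((L 2 3).fun_add (L 3 1)).fun_add (L 1 2)).fderiv]
  simp
  ring

theorem fderiv_F_two (k : ℝ) (a : ℝ → ℝ) (z v : Phase) : fderiv ℝ (F k a 2) z v =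
    v.1 1 * z.2 2 + z.1 1 * v.2 2 - v.1 2 * z.2 1 - z.1 2 * v.2 1 := by
  rw [F_two, (((hasFDerivAt_position 1 z).fun_mul (hasFDerivAt_momentum 2 z)).fun_sub
    ((hasFDerivAt_position 2 z).fun_mul (hasFDerivAt_momentum 1 z))).fderiv]
  simp
  ring

theorem fderiv_F_three (k : ℝ) (a : ℝ → ℝ) (z v : Phase) : fderiv ℝ (F k a 3) z v =
    (1 + k * rsq z.1 / 4) * (k * (z.1 1 * v.1 1 + z.1 2 * v.1 2 + z.1 3 * v.1 3)) *
        (z.2 1 ^ 2 + z.2 2 ^ 2 + z.2 3 ^ 2) +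
      (1 + k * rsq z.1 / 4) ^ 2 * (2 * (z.2 1 * v.2 1 + z.2 2 * v.2 2 + z.2 3 * v.2 3)) := by
  have x (i : Fin 4) := (hasFDerivAt_position i z).pow 2
  have p (i : Fin 4) := (hasFDerivAt_momentum i z).pow 2
  have h := HasFDerivAt.fun_mul (HasFDerivAt.pow (((((x 1).fun_add (x 2)).fun_add (x 3)).const_mul
    (k / 4)).const_add 1) 2) (((p 1).fun_add (p 2)).fun_add (p 3))
  have e : F k a 3 = fun w : Phase => (1 + k / 4 * (w.1 1 ^ 2 + w.1 2 ^ 2 + w.1 3 ^ 2)) ^ 2 *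
      (w.2 1 ^ 2 + w.2 2 ^ 2 + w.2 3 ^ 2) := by
    rw [F_three]; funext w; simp only [spatialEnergy, rsq]; ring
  rw [e, h.fderiv]
  simp [rsq]
  ring

/-- Keeping the differential of `F₄` unexpanded shows `2H` as a function of `t`, `p_t` and `F₄`
alone; the derivative of `a⁻²` enters only as an opaque number. -/
theorem fderiv_F_zero {k : ℝ} {b : EReal} {a : ℝ → ℝ} (ha : ContDiffOn ℝ ∞ a (timeInterval b))
    (ha_pos : ∀ t ∈ timeInterval b, 0 < a t) {z : Phase} (hz : z ∈ cotangentBundle b) (v : Phase) :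
    fderiv ℝ (F k a 0) z v = -2 * z.2 0 * v.2 0 +
      deriv (fun t => (a t ^ 2)⁻¹) (z.1 0) * v.1 0 * F k a 3 z +
      (a (z.1 0) ^ 2)⁻¹ * fderiv ℝ (F k a 3) z v := by
  have hd : DifferentiableAt ℝ (fun t => (a t ^ 2)⁻¹) (z.1 0) :=
    (((ha.contDiffAt ((isOpen_timeInterval b).mem_nhds hz)).differentiableAt (by simp)).pow 2).inv
      (pow_pos (ha_pos _ hz) 2).ne'
  have h1 := hd.hasDerivAt.comp_hasFDerivAt z (hasFDerivAt_position 0 z)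
  simp only [Function.comp_def] at h1
  have h2 : HasFDerivAt (spatialEnergy k) (fderiv ℝ (F k a 3) z) z := by
    rw [F_three]; exact ((contDiff_spatialEnergy k).differentiable (by simp) z).hasFDerivAt
  rw [F_zero, ((((hasFDerivAt_momentum 0 z).pow 2).fun_neg).fun_add (h1.fun_mul h2)).fderiv,
    F_three]
  simp
  ring

/-- This is the Poisson bracket of two integrals. Those with index `1, 2, 3` commute because `L²`
and `F₄` are rotation invariant, and they involve neither `t` nor `p_t`, so they also commute with
`2H`, a function of `t`, `p_t` and `F₄`. -/
theorem fderiv_F_hamVec_F {k : ℝ} {b : EReal} {a : ℝ → ℝ} (ha : ContDiffOn ℝ ∞ a (timeInterval b))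
    (ha_pos : ∀ t ∈ timeInterval b, 0 < a t) {z : Phase} (hz : z ∈ cotangentBundle b)
    (i j : Fin 4) : fderiv ℝ (F k a j) z (hamVec (F k a i) z) = 0 := by
  have h0 := fderiv_F_zero (k := k) ha ha_pos hz
  fin_cases i <;> fin_cases j <;>
  · simp only [Fin.reduceFinMk, Fin.mk_one, Fin.zero_eta, hamVec, h0, fderiv_F_one, fderiv_F_two,
      fderiv_F_three, Pi.single_apply, Pi.zero_apply, Fin.reduceEq, if_true, if_false]
    ring

theorem contDiffAt_F {k : ℝ} {b : EReal} {a : ℝ → ℝ} (ha : ContDiffOn ℝ ∞ a (timeInterval b))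
    (ha_pos : ∀ t ∈ timeInterval b, 0 < a t) {z : Phase} (hz : z ∈ cotangentBundle b) (i : Fin 4) :
    ContDiffAt ℝ ∞ (F k a i) z :=
  (contDiffOn_F ha ha_pos i).contDiffAt ((isOpen_cotangentBundle b).mem_nhds hz)

theorem eq_of_hasDerivWithinAt_zero {J : Set ℝ} (hJ : J.OrdConnected) {f : ℝ → ℝ}
    (hf : ∀ s ∈ J, HasDerivWithinAt f 0 J s) {s t : ℝ} (hs : s ∈ J) (ht : t ∈ J) : f s = f t := by
  have h := hJ.convex.norm_image_sub_le_of_norm_hasDerivWithin_le (C := 0) hf (by simp) hs ht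
  rw [zero_mul, norm_le_zero_iff, sub_eq_zero] at h
  exact h.symm

theorem isInvariant_levelSet {k : ℝ} {b : EReal} {a : ℝ → ℝ}
    (ha : ContDiffOn ℝ ∞ a (timeInterval b)) (ha_pos : ∀ t ∈ timeInterval b, 0 < a t)
    (m lam aθ aφ : ℝ) {G : Phase → ℝ}
    (hG : ∀ z ∈ cotangentBundle b, ∀ j, fderiv ℝ (F k a j) z (hamVec G z) = 0) :
    IsInvariant b G (levelSet k b a m lam aθ aφ) := by
  intro J γ hJ hγ hγ' s₀ hs₀ hmem s hs
  have key (j : Fin 4) : F k a j (γ s) = F k a j (γ s₀) := by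
    refine eq_of_hasDerivWithinAt_zero (f := fun s => F k a j (γ s)) hJ (fun s hs => ?_) hs hs₀
    have h := ((contDiffAt_F (k := k) ha ha_pos (hγ s hs) j).differentiableAt
      (by simp)).hasFDerivAt.comp_hasDerivWithinAt s (hγ' s hs)
    rwa [hG _ (hγ s hs)] at h
  refine ⟨hγ s hs, ?_⟩
  simp only [key]
  exact hmem.2

theorem hamVec_hamiltonian (k : ℝ) (a : ℝ → ℝ) (z : Phase) :
    hamVec (hamiltonian k a) z = (1 / 2 : ℝ) • hamVec (F k a 0) z := by
  have h : fderiv ℝ (F k a 0) z = (2 : ℝ) • fderiv ℝ (hamiltonian k a) z := by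
    have e : F k a 0 = (2 : ℝ) • hamiltonian k a := rfl
    rw [e, fderiv_const_smul_field]; rfl
  ext μ <;> simp [hamVec, h]

/-! ### Linear independence of the differentials. -/

theorem linearIndependent_fderiv_F {k : ℝ} {b : EReal} {a : ℝ → ℝ} {m lam aθ aφ : ℝ}
    (ha : ContDiffOn ℝ ∞ a (timeInterval b)) (ha_pos : ∀ t ∈ timeInterval b, 0 < a t)
    (hm : 0 < m) (hlam : 0 < lam) (haθ : 0 < aθ) (haφ : aφ ^ 2 < aθ ^ 2)
    (hk : k = 0 ∨ (k = 1 ∧ aθ ^ 2 < lam ^ 2)) {z : Phase}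
    (hz : z ∈ levelSet k b a m lam aθ aφ) :
    LinearIndependent ℝ (fun i => fderiv ℝ (F k a i) z) := by
  have hz' := hz.1
  obtain ⟨-, hp, h1, h2, h3⟩ := mem_levelSet.1 hz
  rw [spatialEnergy] at h3
  have hp0 : z.2 0 ≠ 0 := by
    intro h
    rw [h] at hp
    have : 0 ≤ (a (z.1 0) ^ 2)⁻¹ * lam ^ 2 := by positivity
    nlinarith
  rw [Fintype.linearIndependent_iff]
  intro g hg
  have e (v : Phase) : g 0 * fderiv ℝ (F k a 0) z v + g 1 * fderiv ℝ (F k a 1) z v +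
      g 2 * fderiv ℝ (F k a 2) z v + g 3 * fderiv ℝ (F k a 3) z v = 0 := by
    simpa [Fin.sum_univ_four] using congrArg (fun A : Phase →L[ℝ] ℝ => A v) hg
  simp only [fderiv_F_zero ha ha_pos hz', fderiv_F_one, fderiv_F_two, fderiv_F_three] at e
  have g0 : g 0 = 0 := by
    have := e (0, ![1, 0, 0, 0])
    simpa [hp0] using this
  simp only [g0, zero_mul, zero_add] at e
  set l1 := z.1 2 * z.2 3 - z.1 3 * z.2 2 with hl1
  set l2 := z.1 3 * z.2 1 - z.1 1 * z.2 3 with hl2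
  set l3 := z.1 1 * z.2 2 - z.1 2 * z.2 1 with hl3
  have g2 : g 2 = 0 := by
    -- Infinitesimal rotation about the horizontal axis `(l2, -l1, 0)`. It preserves `L²` and `F₄`
    -- and changes `L₃` at rate `l1² + l2²`, which is nonzero because `a_φ² < a_θ²`.
    have := e (![0, -l1 * z.1 3, -l2 * z.1 3, l2 * z.1 2 + l1 * z.1 1],
      ![0, -l1 * z.2 3, -l2 * z.2 3, l2 * z.2 2 + l1 * z.2 1])
    simp only [Matrix.cons_val] at this
    have h0 : l1 ^ 2 + l2 ^ 2 ≠ 0 := by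
      intro h; rw [h, h2] at h1; linarith
    refine (mul_eq_zero.1 (?_ : g 2 * (l1 ^ 2 + l2 ^ 2) = 0)).resolve_right h0
    rw [hl1, hl2] at this ⊢
    rw [hl3] at this
    linarith
  simp only [g2, zero_mul, add_zero] at e
  set u := 1 + k * rsq z.1 / 4 with hu
  have hu0 : u ≠ 0 := by
    intro h; rw [h] at h3
    have := pow_pos hlam 2
    linarith
  set P := z.2 1 ^ 2 + z.2 2 ^ 2 + z.2 3 ^ 2 with hP
  have hP0 : P ≠ 0 := by
    intro h; rw [h] at h3
    have := pow_pos hlam 2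
    linarith
  have g3 : g 3 = 0 := by
    by_contra hne
    -- The shift of `p` along `x` and the scaling `(x, -p)` both leave `x × p` unchanged, so they
    -- isolate the differential of `F₄`. It kills both only if `x·p = 0` and `k r² = 4`.
    have e1 := e (0, ![0, z.1 1, z.1 2, z.1 3])
    have e2 := e (![0, z.1 1, z.1 2, z.1 3], ![0, -z.2 1, -z.2 2, -z.2 3])
    simp only [Matrix.cons_val, Pi.zero_apply] at e1 e2
    have D : z.1 1 * z.2 1 + z.1 2 * z.2 2 + z.1 3 * z.2 3 = 0 := by
      have : g 3 * (u ^ 2 * (2 * (z.1 1 * z.2 1 + z.1 2 * z.2 2 + z.1 3 * z.2 3))) = 0 := by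
        linarith
      simpa [hne, hu0] using this
    have E : k * rsq z.1 = 4 := by
      have : g 3 * (u * P * (k * rsq z.1 - 4)) = 0 := by
        have h4 : z.2 1 * -z.2 1 + z.2 2 * -z.2 2 + z.2 3 * -z.2 3 = -P := by rw [hP]; ring
        have h5 : z.1 1 * z.1 1 + z.1 2 * z.1 2 + z.1 3 * z.1 3 = rsq z.1 := by rw [rsq]; ring
        rw [h4, h5] at e2
        rw [hu] at e2 ⊢
        linarith
      simp only [mul_eq_zero, hne, hu0, hP0, false_or] at this
      linarith
    rcases hk with rfl | ⟨rfl, hk⟩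
    · simp at E
    -- At such a point of the sphere case `r = 2`, hence `L² = 4 |p|² = F₄`: the equatorial great
    -- circles, which `a_θ² < λ²` rules out.
    · rw [one_mul] at E
      have h6 : l1 ^ 2 + l2 ^ 2 + l3 ^ 2 = rsq z.1 * P -
          (z.1 1 * z.2 1 + z.1 2 * z.2 2 + z.1 3 * z.2 3) ^ 2 := by
        rw [hl1, hl2, hl3, hP, rsq]; ring
      rw [hu, E] at h3
      rw [h1, D, E] at h6
      linarith
  have g1 : g 1 = 0 := by
    -- Euler's identity: `L²` is homogeneous of degree two in `p`.
    have := e (0, z.2)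
    simp only [g3, zero_mul, add_zero, Pi.zero_apply] at this
    refine (mul_eq_zero.1 (?_ : g 1 * aθ ^ 2 = 0)).resolve_right (pow_pos haθ 2).ne'
    rw [← h1]
    rw [hl1, hl2, hl3] at this ⊢
    linarith
  intro i
  fin_cases i
  exacts [g0, g1, g2, g3]

/-! ### From independent differentials to a submanifold. -/

/-- A submersion at `z` is the second component of a smooth chart near `z`. -/
theorem exists_chart_of_submersion {U : Set Phase} (hU : IsOpen U) {f : Phase → Fin 4 → ℝ}
    (hf : ContDiffOn ℝ ∞ f U) {z : Phase} (hz : z ∈ U)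
    (hsurj : Function.Surjective (fderiv ℝ f z)) :
    ∃ ψ : OpenPartialHomeomorph Phase ((Fin 4 → ℝ) × (Fin 4 → ℝ)),
      z ∈ ψ.source ∧ ψ.source ⊆ U ∧ ContDiffOn ℝ ∞ ψ ψ.source ∧ ContDiffOn ℝ ∞ ψ.symm ψ.target ∧
      ∀ w ∈ ψ.source, (ψ w).2 = f w - f z := by
  set f' : Phase →ₗ[ℝ] (Fin 4 → ℝ) := (fderiv ℝ f z : Phase →ₗ[ℝ] (Fin 4 → ℝ)) with hf'
  have hker : Module.finrank ℝ (LinearMap.ker f') = Module.finrank ℝ (Fin 4 → ℝ) := by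
    have h1 := LinearMap.finrank_range_add_finrank_ker f'
    rw [LinearMap.range_eq_top.2 hsurj, finrank_top] at h1
    simp at h1 ⊢
    omega
  -- A projection onto the four-dimensional kernel supplies the missing four coordinates: a vector
  -- killed by both the projection and `f'` is zero.
  obtain ⟨P, hP⟩ := (LinearMap.ker f').subtype.exists_leftInverse_of_injective
    (Submodule.ker_subtype _)
  let e := LinearEquiv.ofFinrankEq (LinearMap.ker f') (Fin 4 → ℝ) hker
  let A : Phase →L[ℝ] (Fin 4 → ℝ) := LinearMap.toContinuousLinearMap (e.toLinearMap ∘ₗ P)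
  have hinj : Function.Injective
      ((A.prod (fderiv ℝ f z)).toLinearMap : Phase →ₗ[ℝ] (Fin 4 → ℝ) × (Fin 4 → ℝ)) := by
    rw [← LinearMap.ker_eq_bot, LinearMap.ker_eq_bot']
    intro v hv
    obtain ⟨h1, h2⟩ := Prod.ext_iff.1 hv
    have h1 : e (P v) = 0 := h1
    have h2 : v ∈ LinearMap.ker f' := h2
    have h3 : P v = ⟨v, h2⟩ := LinearMap.congr_fun hP ⟨v, h2⟩
    rw [h3, LinearEquiv.map_eq_zero_iff] at h1
    exact congrArg Subtype.val h1
  let D : Phase ≃L[ℝ] (Fin 4 → ℝ) × (Fin 4 → ℝ) :=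
    (LinearEquiv.ofInjectiveEndo _ hinj).toContinuousLinearEquiv
  let g : Phase → (Fin 4 → ℝ) × (Fin 4 → ℝ) := fun w => (A w, f w - f z)
  have hg : ContDiffOn ℝ ∞ g U := A.contDiff.contDiffOn.prodMk (hf.sub contDiffOn_const)
  have hgz : ContDiffAt ℝ ∞ g z := hg.contDiffAt (hU.mem_nhds hz)
  have hD : HasFDerivAt g (D : Phase →L[ℝ] _) z :=
    A.hasFDerivAt.prodMk ((((hf.contDiffAt (hU.mem_nhds hz)).differentiableAt
      (by simp)).hasFDerivAt).sub_const (f z))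
  -- The inverse function theorem gives a smooth inverse only near the image of `z`. Shrinking the
  -- source to points where the derivative is invertible makes the inverse smooth on the whole
  -- target.
  let V : Set Phase := U ∩ fderiv ℝ g ⁻¹' Set.range
    ((↑) : (Phase ≃L[ℝ] (Fin 4 → ℝ) × (Fin 4 → ℝ)) → (Phase →L[ℝ] (Fin 4 → ℝ) × (Fin 4 → ℝ)))
  have hV : IsOpen V := (hg.continuousOn_fderiv_of_isOpen hU (by simp)).isOpen_inter_preimage hU
    ContinuousLinearEquiv.isOpen
  have hzV : z ∈ V := ⟨hz, D, hD.fderiv.symm⟩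
  let ψ := (hgz.toOpenPartialHomeomorph g hD (by simp)).restrOpen V hV
  have hsub : ψ.source ⊆ V := Set.inter_subset_right
  refine ⟨ψ, ⟨hgz.mem_toOpenPartialHomeomorph_source hD (by simp), hzV⟩,
    fun w hw => (hsub hw).1, hg.mono fun w hw => (hsub hw).1, fun y hy => ?_, fun w _ => rfl⟩
  obtain ⟨hU', E, hE⟩ := hsub (ψ.map_target hy)
  have hgy := hg.contDiffAt (hU.mem_nhds hU')
  refine (ψ.contDiffAt_symm hy (f₀' := E) ?_ hgy).contDiffWithinAt
  rw [hE]
  exact (hgy.differentiableAt (by simp)).hasFDerivAt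

/-- If the range were proper, a nonzero functional would vanish on it, and its coefficients would be
a linear relation among the components. -/
theorem surjective_of_linearIndependent {V : Type*} [AddCommGroup V] [Module ℝ V] {n : ℕ}
    {A : V →ₗ[ℝ] (Fin n → ℝ)}
    (hA : ∀ c : Fin n → ℝ, (∀ v, ∑ i, c i * A v i = 0) → c = 0) : Function.Surjective A := by
  rw [← LinearMap.range_eq_top]
  by_contra h
  obtain ⟨φ, hφ, hle⟩ := Submodule.exists_le_ker_of_lt_top _ (lt_top_iff_ne_top.2 h)
  have hφ' (x : Fin n → ℝ) : φ x = ∑ i, φ (Pi.single i 1) * x i := by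
    conv_lhs => rw [pi_eq_sum_univ' x, map_sum]
    refine Finset.sum_congr rfl fun i _ => ?_
    rw [map_smul, smul_eq_mul, mul_comm]
  have h0 := hA (fun i => φ (Pi.single i 1)) fun v => by
    rw [← hφ']; exact hle ⟨v, rfl⟩
  refine hφ (LinearMap.ext fun x => ?_)
  rw [hφ']
  simp [fun i => congrFun h0 i]

theorem isSmoothSubmanifold_levelSet {k : ℝ} {b : EReal} {a : ℝ → ℝ} {m lam aθ aφ : ℝ}
    (ha : ContDiffOn ℝ ∞ a (timeInterval b)) (ha_pos : ∀ t ∈ timeInterval b, 0 < a t)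
    (hli : ∀ z ∈ levelSet k b a m lam aθ aφ, LinearIndependent ℝ (fun i => fderiv ℝ (F k a i) z)) :
    IsSmoothSubmanifold (levelSet k b a m lam aθ aφ) := by
  intro z hz
  let f : Phase → Fin 4 → ℝ := fun w i => F k a i w
  have hf : ContDiffOn ℝ ∞ f (cotangentBundle b) := contDiffOn_pi.2 fun i => contDiffOn_F ha ha_pos i
  have hd (v : Phase) (i : Fin 4) : fderiv ℝ f z v i = fderiv ℝ (F k a i) z v := by
    rw [fderiv_pi fun i => (contDiffAt_F ha ha_pos hz.1 i).differentiableAt (by simp)]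
    rfl
  have hsurj : Function.Surjective (fderiv ℝ f z) := by
    refine surjective_of_linearIndependent (A := (fderiv ℝ f z : Phase →ₗ[ℝ] Fin 4 → ℝ))
      fun c hc => funext (Fintype.linearIndependent_iff.1 (hli z hz) c ?_)
    refine ContinuousLinearMap.ext fun v => ?_
    simpa [hd] using hc v
  obtain ⟨ψ, h1, h2, h3, h4, h5⟩ :=
    exists_chart_of_submersion (isOpen_cotangentBundle b) hf hz.1 hsurj
  refine ⟨ψ, h1, h3, h4, fun w hw => ?_⟩
  rw [h5 w hw, sub_eq_zero, funext_iff]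
  obtain ⟨-, e0, e1, e2, e3⟩ := hz
  simp only [f, Fin.forall_fin_succ, IsEmpty.forall_iff, and_true, levelSet, Set.mem_ofPred_eq,
    h2 hw, true_and]
  simp only [← e0, ← e1, ← e2, ← e3]
  exact Iff.rfl

/-! ### Stereographic projection and the closed universe. -/

theorem rsq_nonneg (x : Fin 4 → ℝ) : 0 ≤ rsq x := by unfold rsq; positivity

theorem conf_one_mul (x : Fin 4 → ℝ) : conf 1 x * (1 + rsq x / 4) = 1 := by
  have := rsq_nonneg x
  rw [conf, one_mul]
  exact inv_mul_cancel₀ (by positivity)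

theorem conf_one_pos (x : Fin 4 → ℝ) : 0 < conf 1 x := by
  have := rsq_nonneg x
  rw [conf, one_mul]
  positivity

theorem div_conf_one (c : ℝ) (x : Fin 4 → ℝ) : c / conf 1 x = c * (1 + rsq x / 4) := by
  rw [conf, one_mul, div_inv_eq_mul]

theorem sum_sq_toSphere_position (z : Phase) : ∑ j, (toSphere z).1.2 j ^ 2 = 1 := by
  have h := conf_one_mul z.1
  simp only [toSphere, Fin.sum_univ_four, Matrix.cons_val]
  have h2 : (conf 1 z.1 * (1 + rsq z.1 / 4)) ^ 2 = 1 := by rw [h, one_pow]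
  refine Eq.trans ?_ h2
  generalize conf 1 z.1 = f
  simp only [rsq]
  ring

theorem toSphere_position_dot_momentum (z : Phase) :
    ∑ j, (toSphere z).1.2 j * (toSphere z).2.2 j = 0 := by
  simp only [toSphere, Fin.sum_univ_four, Matrix.cons_val, div_conf_one]
  simp only [rsq]
  ring

theorem sum_sq_toSphere_momentum (z : Phase) :
    ∑ j, (toSphere z).2.2 j ^ 2 = spatialEnergy 1 z := by
  simp only [toSphere, Fin.sum_univ_four, Matrix.cons_val, div_conf_one, spatialEnergy]
  simp only [rsq]
  ring

theorem rot_toSphere (z : Phase) :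
    rot (toSphere z) 1 2 = z.1 2 * z.2 3 - z.1 3 * z.2 2 ∧
    rot (toSphere z) 2 0 = z.1 3 * z.2 1 - z.1 1 * z.2 3 ∧
    rot (toSphere z) 0 1 = z.1 1 * z.2 2 - z.1 2 * z.2 1 := by
  have h := conf_one_mul z.1
  simp only [toSphere, rot, Matrix.cons_val, div_conf_one]
  refine ⟨?_, ?_, ?_⟩
  · linear_combination (z.1 2 * z.2 3 - z.1 3 * z.2 2) * h
  · linear_combination (z.1 3 * z.2 1 - z.1 1 * z.2 3) * h
  · linear_combination (z.1 1 * z.2 2 - z.1 2 * z.2 1) * h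

/-- Lagrange's identity in four dimensions: the squared `2 × 2` minors sum to `|y|² |q|² - (y·q)²`.
-/
theorem sum_sq_rot (w : SpherePhase) (h1 : ∑ j, w.1.2 j ^ 2 = 1)
    (h2 : ∑ j, w.1.2 j * w.2.2 j = 0) :
    (rot w 3 0 ^ 2 + rot w 3 1 ^ 2 + rot w 3 2 ^ 2) +
      (rot w 1 2 ^ 2 + rot w 2 0 ^ 2 + rot w 0 1 ^ 2) = ∑ j, w.2.2 j ^ 2 := by
  have h : (rot w 3 0 ^ 2 + rot w 3 1 ^ 2 + rot w 3 2 ^ 2) +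
      (rot w 1 2 ^ 2 + rot w 2 0 ^ 2 + rot w 0 1 ^ 2) =
      (∑ j, w.1.2 j ^ 2) * (∑ j, w.2.2 j ^ 2) - (∑ j, w.1.2 j * w.2.2 j) ^ 2 := by
    simp only [rot, Fin.sum_univ_four]; ring
  rw [h, h1, h2]; ring

theorem toSphere_mem_iff {b : EReal} {a : ℝ → ℝ} {m lam aθ aφ : ℝ} (z : Phase) :
    toSphere z ∈ sphereLevelSet b a m lam aθ aφ ↔ z ∈ levelSet 1 b a m lam aθ aφ := by
  have h1 := sum_sq_toSphere_position z
  have h2 := toSphere_position_dot_momentum z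
  obtain ⟨r1, r2, r3⟩ := rot_toSphere z
  have e := sum_sq_rot _ h1 h2
  rw [r1, r2, r3, sum_sq_toSphere_momentum] at e
  have ht : (toSphere z).1.1 = z.1 0 := rfl
  have hp : (toSphere z).2.1 = z.2 0 := rfl
  simp only [sphereLevelSet, levelSet, Set.mem_ofPred_eq, h1, h2, r1, r2, r3, e,
    sum_sq_toSphere_momentum, F_zero, F_one, F_two, F_three, cotangentBundle, true_and, ht, hp,
    div_eq_inv_mul]

/-- The last coordinate of the sphere point is `2f - 1`, so it determines the conformal factor, then
`x`; the last component of `q` is `-(x·p)`, and then `p` follows. -/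
theorem toSphere_injective : Function.Injective toSphere := by
  intro z w h
  have ht : z.1 0 = w.1 0 := congrArg (fun s : SpherePhase => s.1.1) h
  have hp : z.2 0 = w.2 0 := congrArg (fun s : SpherePhase => s.2.1) h
  have hy (j : Fin 4) := congrArg (fun s : SpherePhase => s.1.2 j) h
  have hq (j : Fin 4) := congrArg (fun s : SpherePhase => s.2.2 j) h
  have y0 := hy 0
  have y1 := hy 1
  have y2 := hy 2
  have y3 := hy 3
  have q0 := hq 0
  have q1 := hq 1
  have q2 := hq 2
  have q3 := hq 3
  simp only [toSphere, Matrix.cons_val] at y0 y1 y2 y3 q0 q1 q2 q3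
  have hc : conf 1 z.1 = conf 1 w.1 := by linarith [conf_one_mul z.1, conf_one_mul w.1]
  have hpos := conf_one_pos w.1
  rw [hc] at y0 y1 y2 q0 q1 q2
  have x1 := mul_left_cancel₀ hpos.ne' y0
  have x2 := mul_left_cancel₀ hpos.ne' y1
  have x3 := mul_left_cancel₀ hpos.ne' y2
  rw [neg_inj] at q3
  rw [q3, x1, sub_left_inj] at q0
  rw [q3, x2, sub_left_inj] at q1
  rw [q3, x3, sub_left_inj] at q2
  have p1 := (div_left_inj' hpos.ne').1 q0
  have p2 := (div_left_inj' hpos.ne').1 q1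
  have p3 := (div_left_inj' hpos.ne').1 q2
  refine Prod.ext (funext fun j => ?_) (funext fun j => ?_) <;> fin_cases j
  exacts [ht, x1, x2, x3, hp, p1, p2, p3]

theorem exists_toSphere_eq {w : SpherePhase} (h1 : ∑ j, w.1.2 j ^ 2 = 1)
    (h2 : ∑ j, w.1.2 j * w.2.2 j = 0) (h3 : w.1.2 3 ≠ -1) : ∃ z, toSphere z = w := by
  obtain ⟨⟨t, y⟩, ⟨pt, q⟩⟩ := w
  simp only [Fin.sum_univ_four] at h1 h2 h3
  have hf0 : 1 + y 3 ≠ 0 := fun h => h3 (by linarith)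
  obtain ⟨f, hf⟩ : ∃ f, f = (1 + y 3) / 2 := ⟨_, rfl⟩
  have hf1 : f ≠ 0 := by rw [hf]; exact div_ne_zero hf0 two_ne_zero
  have hy3 : y 3 = 2 * f - 1 := by rw [hf]; ring
  set x : Fin 4 → ℝ := ![t, y 0 / f, y 1 / f, y 2 / f] with hx
  have hr : f * (1 + rsq x / 4) = 1 := by
    simp only [hx, rsq, Matrix.cons_val]
    field_simp
    rw [hy3] at h1
    linarith
  have hr' : 1 + rsq x / 4 = f⁻¹ := eq_inv_of_mul_eq_one_right hr
  have hc : conf 1 x = f := by rw [conf, one_mul, hr', inv_inv]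
  -- Solves `q_i = p_i / f - x_i (x·p) / 2` for `p_i`, using `x·p = -q_4`.
  set z : Phase := (x, ![pt, f * (q 0 - x 1 * q 3 / 2), f * (q 1 - x 2 * q 3 / 2),
    f * (q 2 - x 3 * q 3 / 2)]) with hz
  have e1 : z.1 = x := rfl
  have x1 : f * x 1 = y 0 := by simp only [hx, Matrix.cons_val]; field_simp
  have x2 : f * x 2 = y 1 := by simp only [hx, Matrix.cons_val]; field_simp
  have x3 : f * x 3 = y 2 := by simp only [hx, Matrix.cons_val]; field_simp
  have hD : x 1 * z.2 1 + x 2 * z.2 2 + x 3 * z.2 3 = -q 3 := by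
    simp only [hz, Matrix.cons_val]
    have : x 1 * (f * (q 0 - x 1 * q 3 / 2)) + x 2 * (f * (q 1 - x 2 * q 3 / 2)) +
        x 3 * (f * (q 2 - x 3 * q 3 / 2)) = f * x 1 * q 0 + f * x 2 * q 1 + f * x 3 * q 2 -
          f * rsq x * q 3 / 2 := by rw [rsq]; ring
    rw [this, x1, x2, x3]
    rw [hy3] at h2
    linear_combination h2 - 2 * q 3 * hr
  refine ⟨z, ?_⟩
  refine Prod.ext (Prod.ext rfl (funext fun j => ?_)) (Prod.ext rfl (funext fun j => ?_))
  · simp only [toSphere, e1, hc]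
    fin_cases j
    · exact x1
    · exact x2
    · exact x3
    · change f * (1 - rsq x / 4) = y 3
      linarith
  · simp only [toSphere, e1, hc, hD]
    fin_cases j <;> simp only [hz, Fin.reduceFinMk, Fin.mk_one, Fin.zero_eta, Matrix.cons_val,
      mul_div_cancel_left₀ _ hf1] <;> ring

theorem bijOn_toSphere (b : EReal) (a : ℝ → ℝ) (m lam aφ : ℝ) {aθ : ℝ} (haθ : 0 < aθ) :
    Set.BijOn toSphere (levelSet 1 b a m lam aθ aφ) (sphereLevelSet b a m lam aθ aφ) := by
  refine ⟨fun z hz => (toSphere_mem_iff z).2 hz, toSphere_injective.injOn, fun w hw => ?_⟩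
  obtain ⟨-, h1, h2, -, h4, -⟩ := id hw
  -- At the omitted pole the first three coordinates of `y` vanish, hence so does `L`, contradicting
  -- `a_θ > 0`.
  have h3 : w.1.2 3 ≠ -1 := by
    intro h
    rw [Fin.sum_univ_four, h] at h1
    have s0 := sq_nonneg (w.1.2 0)
    have s1 := sq_nonneg (w.1.2 1)
    have s2 := sq_nonneg (w.1.2 2)
    have z0 : w.1.2 0 = 0 := pow_eq_zero_iff two_ne_zero |>.1 (by linarith)
    have z1 : w.1.2 1 = 0 := pow_eq_zero_iff two_ne_zero |>.1 (by linarith)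
    have z2 : w.1.2 2 = 0 := pow_eq_zero_iff two_ne_zero |>.1 (by linarith)
    simp only [rot, z0, z1, z2] at h4
    have := pow_pos haθ 2
    linarith
  obtain ⟨z, rfl⟩ := exists_toSphere_eq h1 h2 h3
  exact ⟨z, (toSphere_mem_iff z).1 hw, rfl⟩

/-! ### Parametrization of the two branches. -/

/-- A homeomorphism between two subsets given by mutually inverse maps of the ambient spaces. -/
def homeomorphOfInvOn {X Y : Type*} [TopologicalSpace X] [TopologicalSpace Y] {S : Set X}
    {T : Set Y} (f : X → Y) (g : Y → X) (hf : ContinuousOn f S) (hg : ContinuousOn g T)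
    (hST : Set.MapsTo f S T) (hTS : Set.MapsTo g T S) (h : Set.InvOn g f S T) : S ≃ₜ T where
  toFun := hST.restrict f S T
  invFun := hTS.restrict g T S
  left_inv x := Subtype.ext (h.1 x.2)
  right_inv y := Subtype.ext (h.2 y.2)
  continuous_toFun := hf.mapsToRestrict hST
  continuous_invFun := hg.mapsToRestrict hTS

/-- The unit circle in the plane. -/
def unitCircle : Set (ℝ × ℝ) := {q | q.1 ^ 2 + q.2 ^ 2 = 1}

/-- The unit circle of the plane is the unit circle of `ℂ`. -/
def unitCircleHomeomorph : unitCircle ≃ₜ Circle where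
  toFun q := ⟨⟨q.1.1, q.1.2⟩, by
    refine mem_sphere_zero_iff_norm.2 ?_
    rw [← sq_eq_sq₀ (norm_nonneg _) zero_le_one, Complex.sq_norm, Complex.normSq_mk]
    have := q.2
    simp only [unitCircle, Set.mem_ofPred_eq] at this
    linarith⟩
  invFun c := ⟨((c : ℂ).re, (c : ℂ).im), by
    have := Circle.normSq_coe c
    rw [Complex.normSq_apply] at this
    simp only [unitCircle, Set.mem_ofPred_eq]
    linarith⟩
  left_inv _ := rfl
  right_inv _ := rfl
  continuous_toFun := by
    refine Continuous.subtype_mk ?_ _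
    exact Complex.equivRealProdCLM.symm.continuous.comp continuous_subtype_val
  continuous_invFun := by
    refine Continuous.subtype_mk ?_ _
    exact (Complex.continuous_re.comp continuous_subtype_val).prodMk
      (Complex.continuous_im.comp continuous_subtype_val)

/-- The curve of the values of `(r, x · p)` on the level set. -/
def radialCurve (k lam aθ : ℝ) : Set (ℝ × ℝ) :=
  {q | 0 < q.1 ∧ (q.2 ^ 2 + aθ ^ 2) * (1 + k * q.1 ^ 2 / 4) ^ 2 = q.1 ^ 2 * lam ^ 2}

/-- The parameters `(t, u, v, (r, x · p))` of the level set: `u` is the direction of the horizontal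
part of the angular momentum `L`, and `v` the direction of `x` in the plane orthogonal to `L`. -/
def paramSet (k : ℝ) (b : EReal) (lam aθ : ℝ) : Set (ℝ × (ℝ × ℝ) × (ℝ × ℝ) × (ℝ × ℝ)) :=
  timeInterval b ×ˢ unitCircle ×ˢ unitCircle ×ˢ radialCurve k lam aθ

/-- The unit vector at angle `v` in the plane orthogonal to `(s u₁, s u₂, w)`. -/
def frameVec (w s : ℝ) (u v : ℝ × ℝ) : Fin 3 → ℝ :=
  ![-(v.1 * u.2) - v.2 * w * u.1, v.1 * u.1 - v.2 * w * u.2, v.2 * s]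

/-- The vector `frameVec w s u v` rotated by a right angle in its plane. -/
def frameVec' (w s : ℝ) (u v : ℝ × ℝ) : Fin 3 → ℝ := frameVec w s u (-v.2, v.1)

theorem frameVec_norm {w s : ℝ} {u v : ℝ × ℝ} (h : w ^ 2 + s ^ 2 = 1) (hu : u ∈ unitCircle)
    (hv : v ∈ unitCircle) :
    frameVec w s u v 0 ^ 2 + frameVec w s u v 1 ^ 2 + frameVec w s u v 2 ^ 2 = 1 := by
  simp only [unitCircle, Set.mem_ofPred_eq] at hu hv
  simp only [frameVec, Matrix.cons_val]
  linear_combination (v.1 ^ 2 + v.2 ^ 2 * w ^ 2) * hu + v.2 ^ 2 * h + hv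

theorem frameVec'_norm {w s : ℝ} {u v : ℝ × ℝ} (h : w ^ 2 + s ^ 2 = 1) (hu : u ∈ unitCircle)
    (hv : v ∈ unitCircle) :
    frameVec' w s u v 0 ^ 2 + frameVec' w s u v 1 ^ 2 + frameVec' w s u v 2 ^ 2 = 1 :=
  frameVec_norm h hu (by simp only [unitCircle, Set.mem_ofPred_eq] at hv ⊢; linarith)

theorem frameVec_dot {w s : ℝ} {u v : ℝ × ℝ} (h : w ^ 2 + s ^ 2 = 1) (hu : u ∈ unitCircle) :
    frameVec w s u v 0 * frameVec' w s u v 0 + frameVec w s u v 1 * frameVec' w s u v 1 +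
      frameVec w s u v 2 * frameVec' w s u v 2 = 0 := by
  simp only [unitCircle, Set.mem_ofPred_eq] at hu
  simp only [frameVec, frameVec', Matrix.cons_val]
  linear_combination v.1 * v.2 * (w ^ 2 - 1) * hu + v.1 * v.2 * h

theorem frameVec_cross {w s : ℝ} {u v : ℝ × ℝ} (hu : u ∈ unitCircle) (hv : v ∈ unitCircle) :
    frameVec w s u v 1 * frameVec' w s u v 2 - frameVec w s u v 2 * frameVec' w s u v 1 = s * u.1 ∧
    frameVec w s u v 2 * frameVec' w s u v 0 - frameVec w s u v 0 * frameVec' w s u v 2 = s * u.2 ∧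
    frameVec w s u v 0 * frameVec' w s u v 1 - frameVec w s u v 1 * frameVec' w s u v 0 = w := by
  simp only [unitCircle, Set.mem_ofPred_eq] at hu hv
  simp only [frameVec, frameVec', Matrix.cons_val]
  refine ⟨?_, ?_, ?_⟩
  · linear_combination s * u.1 * hv
  · linear_combination s * u.2 * hv
  · linear_combination w * (v.1 ^ 2 + v.2 ^ 2) * hu + w * hv

/-- The part of the level set on which `p_t` has the sign of `σ`. -/
def branch (k : ℝ) (b : EReal) (a : ℝ → ℝ) (m lam aθ aφ σ : ℝ) : Set Phase :=
  {z | z ∈ levelSet k b a m lam aθ aφ ∧ 0 < σ * z.2 0}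

/-- The point of the level set with given parameters; `ρ` is the length of the horizontal part of
the angular momentum. -/
def ofParam (a : ℝ → ℝ) (m lam aθ aφ ρ σ : ℝ) (q : ℝ × (ℝ × ℝ) × (ℝ × ℝ) × (ℝ × ℝ)) : Phase :=
  (![q.1, q.2.2.2.1 * frameVec (aφ / aθ) (ρ / aθ) q.2.1 q.2.2.1 0,
      q.2.2.2.1 * frameVec (aφ / aθ) (ρ / aθ) q.2.1 q.2.2.1 1,
      q.2.2.2.1 * frameVec (aφ / aθ) (ρ / aθ) q.2.1 q.2.2.1 2],
   ![σ * √(m ^ 2 + (a q.1 ^ 2)⁻¹ * lam ^ 2),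
      (q.2.2.2.2 * frameVec (aφ / aθ) (ρ / aθ) q.2.1 q.2.2.1 0 +
        aθ * frameVec' (aφ / aθ) (ρ / aθ) q.2.1 q.2.2.1 0) / q.2.2.2.1,
      (q.2.2.2.2 * frameVec (aφ / aθ) (ρ / aθ) q.2.1 q.2.2.1 1 +
        aθ * frameVec' (aφ / aθ) (ρ / aθ) q.2.1 q.2.2.1 1) / q.2.2.2.1,
      (q.2.2.2.2 * frameVec (aφ / aθ) (ρ / aθ) q.2.1 q.2.2.1 2 +
        aθ * frameVec' (aφ / aθ) (ρ / aθ) q.2.1 q.2.2.1 2) / q.2.2.2.1])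

/-- The parameters of a point of the level set. -/
def toParam (aθ ρ : ℝ) (z : Phase) : ℝ × (ℝ × ℝ) × (ℝ × ℝ) × (ℝ × ℝ) :=
  (z.1 0,
    ((z.1 2 * z.2 3 - z.1 3 * z.2 2) / ρ, (z.1 3 * z.2 1 - z.1 1 * z.2 3) / ρ),
    ((z.1 2 * (z.1 2 * z.2 3 - z.1 3 * z.2 2) - z.1 1 * (z.1 3 * z.2 1 - z.1 1 * z.2 3)) /
      (ρ * radius z), aθ * z.1 3 / (ρ * radius z)),
    (radius z, z.1 1 * z.2 1 + z.1 2 * z.2 2 + z.1 3 * z.2 3))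

section

variable {k : ℝ} {b : EReal} {a : ℝ → ℝ} {m lam aθ aφ ρ σ : ℝ}

/-- Here `x = r X` and `p = (D X + a_θ Y) / r` with `X, Y` orthonormal and `a_θ X × Y = (ρ u₁, ρ u₂,
a_φ)`. So `x·p = D`, `r² |p|² = D² + a_θ²`, and `x × p` is the prescribed angular momentum. -/
theorem ofParam_spec (haθ : 0 < aθ) (hρ : aφ ^ 2 + ρ ^ 2 = aθ ^ 2)
    {q : ℝ × (ℝ × ℝ) × (ℝ × ℝ) × (ℝ × ℝ)} (hq : q ∈ paramSet k b lam aθ) {z : Phase}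
    (hz : z = ofParam a m lam aθ aφ ρ σ q) :
    rsq z.1 = q.2.2.2.1 ^ 2 ∧ z.1 1 * z.2 1 + z.1 2 * z.2 2 + z.1 3 * z.2 3 = q.2.2.2.2 ∧
    z.2 1 ^ 2 + z.2 2 ^ 2 + z.2 3 ^ 2 = (q.2.2.2.2 ^ 2 + aθ ^ 2) / q.2.2.2.1 ^ 2 ∧
    z.1 2 * z.2 3 - z.1 3 * z.2 2 = ρ * q.2.1.1 ∧ z.1 3 * z.2 1 - z.1 1 * z.2 3 = ρ * q.2.1.2 ∧
    z.1 1 * z.2 2 - z.1 2 * z.2 1 = aφ := by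
  obtain ⟨t, u, v, r, D⟩ := q
  obtain ⟨-, hu, hv, hr, -⟩ := hq
  have hws : (aφ / aθ) ^ 2 + (ρ / aθ) ^ 2 = 1 := by field_simp; exact hρ
  have n1 := frameVec_norm hws hu hv
  have n2 := frameVec'_norm hws hu hv
  have d := frameVec_dot (v := v) hws hu
  obtain ⟨c1, c2, c3⟩ := frameVec_cross (w := aφ / aθ) (s := ρ / aθ) hu hv
  simp only [ofParam] at hz
  set X := frameVec (aφ / aθ) (ρ / aθ) u v
  set Y := frameVec' (aφ / aθ) (ρ / aθ) u v
  simp only at hr ⊢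
  subst hz
  simp only [rsq, Matrix.cons_val]
  have hr' := hr.ne'
  have c1' : aθ * (X 1 * Y 2 - X 2 * Y 1) = ρ * u.1 := by rw [c1]; field_simp
  have c2' : aθ * (X 2 * Y 0 - X 0 * Y 2) = ρ * u.2 := by rw [c2]; field_simp
  have c3' : aθ * (X 0 * Y 1 - X 1 * Y 0) = aφ := by rw [c3]; field_simp
  refine ⟨?_, ?_, ?_, ?_, ?_, ?_⟩
  · linear_combination r ^ 2 * n1
  · field_simp
    linear_combination D * n1 + aθ * d
  · field_simp
    linear_combination D ^ 2 * n1 + aθ ^ 2 * n2 + 2 * D * aθ * d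
  · rw [← c1']; field_simp; ring
  · rw [← c2']; field_simp; ring
  · rw [← c3']; field_simp; ring

theorem mapsTo_ofParam (hm : 0 < m) (haθ : 0 < aθ) (hρ : aφ ^ 2 + ρ ^ 2 = aθ ^ 2)
    (hσ : σ ^ 2 = 1) : Set.MapsTo (ofParam a m lam aθ aφ ρ σ) (paramSet k b lam aθ)
      (branch k b a m lam aθ aφ σ) := by
  intro q hq
  obtain ⟨h1, -, h3, h4, h5, h6⟩ := ofParam_spec haθ hρ hq rfl (a := a) (m := m) (σ := σ)
  obtain ⟨ht, hu, -, hr, hC⟩ := hq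
  have hpos : 0 < m ^ 2 + (a q.1 ^ 2)⁻¹ * lam ^ 2 := by positivity
  refine ⟨mem_levelSet.2 ⟨ht, ?_, ?_, h6, ?_⟩, ?_⟩
  · change (σ * √(m ^ 2 + (a q.1 ^ 2)⁻¹ * lam ^ 2)) ^ 2 = m ^ 2 + (a q.1 ^ 2)⁻¹ * lam ^ 2
    rw [mul_pow, hσ, one_mul, Real.sq_sqrt hpos.le]
  · simp only [unitCircle, Set.mem_ofPred_eq] at hu
    rw [h4, h5, h6]
    linear_combination ρ ^ 2 * hu + hρ
  · have hr' := hr.ne'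
    rw [spatialEnergy, h1, h3, ← mul_div_assoc, mul_comm, hC]
    field_simp
  · change 0 < σ * (σ * √(m ^ 2 + (a q.1 ^ 2)⁻¹ * lam ^ 2))
    rw [← mul_assoc, ← sq, hσ, one_mul]
    exact Real.sqrt_pos.2 hpos

/-- By Lagrange's identity `r² |p|² = a_θ² + (x·p)² > 0`, so polar decomposition of `x` is
legitimate on the level set. -/
theorem rsq_pos_of_mem_levelSet {z : Phase} (haθ : 0 < aθ)
    (hz : z ∈ levelSet k b a m lam aθ aφ) : 0 < rsq z.1 := by
  obtain ⟨-, -, h, -⟩ := mem_levelSet.1 hz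
  have e : aθ ^ 2 + (z.1 1 * z.2 1 + z.1 2 * z.2 2 + z.1 3 * z.2 3) ^ 2 =
      rsq z.1 * (z.2 1 ^ 2 + z.2 2 ^ 2 + z.2 3 ^ 2) := by rw [← h, rsq]; ring
  refine (rsq_nonneg _).lt_of_ne fun h0 => ?_
  rw [← h0, zero_mul] at e
  have := pow_pos haθ 2
  nlinarith [sq_nonneg (z.1 1 * z.2 1 + z.1 2 * z.2 2 + z.1 3 * z.2 3)]

theorem radius_mem_radialCurve {z : Phase} (haθ : 0 < aθ)
    (hz : z ∈ levelSet k b a m lam aθ aφ) :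
    (radius z, z.1 1 * z.2 1 + z.1 2 * z.2 2 + z.1 3 * z.2 3) ∈ radialCurve k lam aθ := by
  have hr := rsq_pos_of_mem_levelSet haθ hz
  obtain ⟨-, -, h, -, h'⟩ := mem_levelSet.1 hz
  refine ⟨Real.sqrt_pos.2 hr, ?_⟩
  simp only [radius, Real.sq_sqrt hr.le]
  rw [← h, ← h', spatialEnergy]
  simp only [rsq]
  ring

theorem mapsTo_toParam (haθ : 0 < aθ) (hρ0 : 0 < ρ) (hρ : aφ ^ 2 + ρ ^ 2 = aθ ^ 2) :
    Set.MapsTo (toParam aθ ρ) (branch k b a m lam aθ aφ σ) (paramSet k b lam aθ) := by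
  intro z hz
  have hr := rsq_pos_of_mem_levelSet haθ hz.1
  have hC := radius_mem_radialCurve haθ hz.1
  obtain ⟨ht, -, h, h3, -⟩ := mem_levelSet.1 hz.1
  have hu : (z.1 2 * z.2 3 - z.1 3 * z.2 2) ^ 2 + (z.1 3 * z.2 1 - z.1 1 * z.2 3) ^ 2 = ρ ^ 2 := by
    rw [h3] at h; linarith
  refine ⟨ht, ?_, ?_, hC⟩
  · simp only [unitCircle, Set.mem_ofPred_eq, toParam]
    field_simp
    linear_combination hu
  · have hR : radius z ≠ 0 := hC.1.ne'
    have hR2 : radius z ^ 2 = rsq z.1 := Real.sq_sqrt hr.le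
    -- Orthogonality `x·L = 0`. It gives `(y l1 - x l2)² = (x² + y²) ρ² - z² a_φ²`, and adding `a_θ²
    -- z²` produces `ρ² r²`.
    have hp : z.1 1 * (z.1 2 * z.2 3 - z.1 3 * z.2 2) + z.1 2 * (z.1 3 * z.2 1 - z.1 1 * z.2 3) =
      -(z.1 3 * aφ) := by rw [← h3]; ring
    simp only [unitCircle, Set.mem_ofPred_eq, toParam]
    field_simp
    rw [hR2, rsq]
    set l1 := z.1 2 * z.2 3 - z.1 3 * z.2 2
    set l2 := z.1 3 * z.2 1 - z.1 1 * z.2 3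
    linear_combination (z.1 1 ^ 2 + z.1 2 ^ 2) * hu - z.1 3 ^ 2 * hρ -
      (z.1 1 * l1 + z.1 2 * l2 - z.1 3 * aφ) * hp

theorem leftInvOn_toParam (haθ : 0 < aθ) (hρ0 : 0 < ρ) (hρ : aφ ^ 2 + ρ ^ 2 = aθ ^ 2)
    (hσ : σ ^ 2 = 1) : Set.LeftInvOn (ofParam a m lam aθ aφ ρ σ) (toParam aθ ρ)
      (branch k b a m lam aθ aφ σ) := by
  intro z hz
  have hr := rsq_pos_of_mem_levelSet haθ hz.1
  obtain ⟨-, hp0, h, h3, -⟩ := mem_levelSet.1 hz.1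
  have hσz := hz.2
  have hu : (z.1 2 * z.2 3 - z.1 3 * z.2 2) ^ 2 + (z.1 3 * z.2 1 - z.1 1 * z.2 3) ^ 2 = ρ ^ 2 := by
    rw [h3] at h; linarith
  have hR : radius z ≠ 0 := (Real.sqrt_pos.2 hr).ne'
  have hR2 : radius z ^ 2 = rsq z.1 := Real.sq_sqrt hr.le
  have hp : z.1 1 * (z.1 2 * z.2 3 - z.1 3 * z.2 2) + z.1 2 * (z.1 3 * z.2 1 - z.1 1 * z.2 3) +
    z.1 3 * aφ = 0 := by rw [← h3]; ring
  -- The three components of `r² p = (x·p) x - x × L`, which recovers `p` from the parameters.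
  have hp1 : rsq z.1 * z.2 1 = (z.1 1 * z.2 1 + z.1 2 * z.2 2 + z.1 3 * z.2 3) * z.1 1 -
      (z.1 2 * aφ - z.1 3 * (z.1 3 * z.2 1 - z.1 1 * z.2 3)) := by rw [← h3, rsq]; ring
  have hp2 : rsq z.1 * z.2 2 = (z.1 1 * z.2 1 + z.1 2 * z.2 2 + z.1 3 * z.2 3) * z.1 2 -
      (z.1 3 * (z.1 2 * z.2 3 - z.1 3 * z.2 2) - z.1 1 * aφ) := by rw [← h3, rsq]; ring
  have hp3 : rsq z.1 * z.2 3 = (z.1 1 * z.2 1 + z.1 2 * z.2 2 + z.1 3 * z.2 3) * z.1 3 -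
      (z.1 1 * (z.1 3 * z.2 1 - z.1 1 * z.2 3) - z.1 2 * (z.1 2 * z.2 3 - z.1 3 * z.2 2)) := by
    rw [rsq]; ring
  refine Prod.ext (funext fun j => ?_) (funext fun j => ?_)
  · simp only [ofParam, toParam, frameVec]
    set l1 := z.1 2 * z.2 3 - z.1 3 * z.2 2
    set l2 := z.1 3 * z.2 1 - z.1 1 * z.2 3
    fin_cases j <;> simp only [Fin.reduceFinMk, Fin.mk_one, Fin.zero_eta, Matrix.cons_val]
    · field_simp
      linear_combination z.1 1 * hu - l1 * hp
    · field_simp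
      linear_combination z.1 2 * hu - l2 * hp
    · field_simp
  · simp only [ofParam, toParam, frameVec, frameVec']
    set l1 := z.1 2 * z.2 3 - z.1 3 * z.2 2
    set l2 := z.1 3 * z.2 1 - z.1 1 * z.2 3
    set D := z.1 1 * z.2 1 + z.1 2 * z.2 2 + z.1 3 * z.2 3
    fin_cases j <;> simp only [Fin.reduceFinMk, Fin.mk_one, Fin.zero_eta, Matrix.cons_val]
    -- The square root is `|p_t|`, and `σ p_t > 0` with `|σ| = 1` makes `σ |p_t| = p_t`; multiplying
    -- through by `σ` reduces the goal to `|p_t| = σ p_t`.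
    · rw [← hp0, Real.sqrt_sq_eq_abs, ← mul_right_inj' (show σ ≠ 0 by rintro rfl; simp at hσ),
        ← mul_assoc, ← sq, hσ, one_mul]
      have h1 : |σ| = 1 := by rw [← sq_eq_sq₀ (abs_nonneg _) zero_le_one, sq_abs, hσ, one_pow]
      rw [← abs_of_pos hσz, abs_mul, h1, one_mul]
    · field_simp
      rw [hR2]
      linear_combination -ρ ^ 2 * hp1 + (aφ * l2 - D * l1) * hp + (D * z.1 1 - aφ * z.1 2) * hu -
        l2 * z.1 3 * hρ
    · field_simp
      rw [hR2]
      linear_combination -ρ ^ 2 * hp2 - (aφ * l1 + D * l2) * hp + (D * z.1 2 + aφ * z.1 1) * hu +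
        l1 * z.1 3 * hρ
    · field_simp
      rw [hR2]
      linear_combination -hp3

theorem rightInvOn_toParam (haθ : 0 < aθ) (hρ0 : 0 < ρ) (hρ : aφ ^ 2 + ρ ^ 2 = aθ ^ 2) :
    Set.LeftInvOn (toParam aθ ρ) (ofParam a m lam aθ aφ ρ σ) (paramSet k b lam aθ) := by
  intro q hq
  obtain ⟨h1, h2, -, h4, h5, h6⟩ := ofParam_spec haθ hρ hq rfl (a := a) (m := m) (σ := σ)
  obtain ⟨t, u, v, r, D⟩ := q
  obtain ⟨-, hu, hv, hr, -⟩ := hq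
  simp only [unitCircle, Set.mem_ofPred_eq] at hr h1 h2 h4 h5 h6 hu hv
  have hR : radius (ofParam a m lam aθ aφ ρ σ (t, u, v, r, D)) = r := by
    rw [radius, h1, Real.sqrt_sq hr.le]
  simp only [toParam, h2, h4, h5, hR]
  have hr' := hr.ne'
  refine Prod.ext rfl (Prod.ext (Prod.ext ?_ ?_) (Prod.ext (Prod.ext ?_ ?_) rfl))
  · simp only; field_simp
  · simp only; field_simp
  · simp only [ofParam, frameVec, Matrix.cons_val]
    field_simp
    linear_combination aθ * v.1 * hu
  · simp only [ofParam, frameVec, Matrix.cons_val]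
    field_simp

theorem continuousOn_ofParam (ha : ContinuousOn a (timeInterval b))
    (ha_pos : ∀ t ∈ timeInterval b, 0 < a t) :
    ContinuousOn (ofParam a m lam aθ aφ ρ σ) (paramSet k b lam aθ) := by
  have h1 : ContinuousOn (fun q : ℝ × (ℝ × ℝ) × (ℝ × ℝ) × (ℝ × ℝ) => (a q.1 ^ 2)⁻¹)
      (paramSet k b lam aθ) :=
    ((ha.comp continuousOn_fst fun q hq => hq.1).pow 2).inv₀
      fun q hq => (pow_pos (ha_pos _ hq.1) 2).ne'
  have h2 : ∀ q ∈ paramSet k b lam aθ, q.2.2.2.1 ≠ 0 := fun q hq => hq.2.2.2.1.ne'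
  have h3 := continuousOn_pi.2 fun j : Fin 4 => (show ContinuousOn
    (fun q => (ofParam a m lam aθ aφ ρ σ q).1 j) (paramSet k b lam aθ) by
      fin_cases j <;> simp [ofParam, frameVec] <;> fun_prop)
  have h4 := continuousOn_pi.2 fun j : Fin 4 => (show ContinuousOn
    (fun q => (ofParam a m lam aθ aφ ρ σ q).2 j) (paramSet k b lam aθ) by
      fin_cases j
      · change ContinuousOn (fun q : ℝ × (ℝ × ℝ) × (ℝ × ℝ) × (ℝ × ℝ) =>
          σ * √(m ^ 2 + (a q.1 ^ 2)⁻¹ * lam ^ 2)) _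
        fun_prop
      all_goals
        simp [ofParam, frameVec, frameVec']
        refine ContinuousOn.div (by fun_prop) (by fun_prop) h2)
  exact h3.prodMk h4

theorem continuousOn_toParam (haθ : 0 < aθ) (hρ0 : 0 < ρ) :
    ContinuousOn (toParam aθ ρ) (branch k b a m lam aθ aφ σ) := by
  have hR : Continuous radius := by unfold radius rsq; fun_prop
  have h : ∀ z ∈ branch k b a m lam aθ aφ σ, ρ * radius z ≠ 0 := fun z hz =>
    (mul_pos hρ0 (Real.sqrt_pos.2 (rsq_pos_of_mem_levelSet haθ hz.1))).ne'
  unfold toParam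
  refine ContinuousOn.prodMk (by fun_prop) (ContinuousOn.prodMk (by fun_prop)
    (ContinuousOn.prodMk (ContinuousOn.prodMk ?_ ?_) (by fun_prop)))
  · exact ContinuousOn.div (by fun_prop) (by fun_prop) h
  · exact ContinuousOn.div (by fun_prop) (by fun_prop) h

/-- Each branch of the level set is homeomorphic to its set of parameters. -/
def branchHomeomorph (ha : ContinuousOn a (timeInterval b))
    (ha_pos : ∀ t ∈ timeInterval b, 0 < a t) (hm : 0 < m) (haθ : 0 < aθ) (hρ0 : 0 < ρ)
    (hρ : aφ ^ 2 + ρ ^ 2 = aθ ^ 2) (hσ : σ ^ 2 = 1) :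
    branch k b a m lam aθ aφ σ ≃ₜ paramSet k b lam aθ :=
  homeomorphOfInvOn (toParam aθ ρ) (ofParam a m lam aθ aφ ρ σ) (continuousOn_toParam haθ hρ0)
    (continuousOn_ofParam ha ha_pos) (mapsTo_toParam haθ hρ0 hρ) (mapsTo_ofParam hm haθ hρ hσ)
    ⟨leftInvOn_toParam haθ hρ0 hρ hσ, rightInvOn_toParam haθ hρ0 hρ⟩

end

/-! ### Topology of the factors: time interval and radial curve. -/

theorem nonempty_timeInterval {b : EReal} (hb : 0 < b) : (timeInterval b).Nonempty := by
  obtain ⟨t, h0, ht⟩ := EReal.lt_iff_exists_real_btwn.1 hb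
  exact ⟨t, EReal.coe_pos.1 h0, ht⟩

theorem nonempty_timeInterval_homeomorph {b : EReal} (hb : 0 < b) :
    Nonempty (timeInterval b ≃ₜ ℝ) := by
  induction b with
  | bot => simp at hb
  | top =>
    refine ⟨(homeomorphOfInvOn (T := Set.univ) Real.log Real.exp ?_ Real.continuous_exp.continuousOn
      (fun _ _ => trivial) ?_ ⟨?_, ?_⟩).trans (Homeomorph.Set.univ ℝ)⟩
    · exact Real.continuousOn_log.mono fun t ht => ht.1.ne'
    · exact fun t _ => ⟨Real.exp_pos t, EReal.coe_lt_top _⟩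
    · exact fun t ht => Real.exp_log ht.1
    · exact fun t _ => Real.log_exp t
  | coe c =>
    have hc : 0 < c := EReal.coe_pos.1 hb
    have hmem (t : ℝ) : t ∈ timeInterval c ↔ 0 < t ∧ t < c := by
      simp [timeInterval, EReal.coe_lt_coe_iff]
    -- The logit map of `(0, c)` onto the line, with the rescaled logistic function as inverse.
    refine ⟨(homeomorphOfInvOn (T := Set.univ) (fun t => Real.log (t / (c - t)))
      (fun s => c * Real.exp s / (1 + Real.exp s)) ?_ ?_
      (fun _ _ => trivial) ?_ ⟨?_, ?_⟩).trans (Homeomorph.Set.univ ℝ)⟩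
    · refine ContinuousOn.log (ContinuousOn.div (by fun_prop) (by fun_prop) ?_) ?_
      · intro t ht
        exact (sub_pos.2 ((hmem t).1 ht).2).ne'
      · intro t ht
        exact (div_pos ht.1 (sub_pos.2 ((hmem t).1 ht).2)).ne'
    · refine Continuous.continuousOn (Continuous.div (by fun_prop) (by fun_prop) fun s => ?_)
      positivity
    · intro s _
      rw [hmem, div_lt_iff₀ (by positivity)]
      exact ⟨by positivity, by linarith⟩
    · intro t ht
      have h1 := sub_pos.2 ((hmem t).1 ht).2
      have h2 : 1 + t / (c - t) = c / (c - t) := by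
        field_simp
        ring
      simp only [Real.exp_log (div_pos ht.1 h1), h2]
      field_simp
    · intro s _
      have : c * Real.exp s / (1 + Real.exp s) / (c - c * Real.exp s / (1 + Real.exp s)) =
          Real.exp s := by
        have : c - c * Real.exp s / (1 + Real.exp s) = c / (1 + Real.exp s) := by
          field_simp
          ring
        rw [this]
        field_simp
      simp only [this, Real.log_exp]

/-- In the flat case the radial curve is a branch of a hyperbola. -/
def radialCurveZeroHomeomorph {lam aθ : ℝ} (hlam : 0 < lam) (haθ : 0 < aθ) :
    radialCurve 0 lam aθ ≃ₜ ℝ :=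
  (homeomorphOfInvOn (T := Set.univ) (fun q : ℝ × ℝ => q.2)
    (fun D => (√(D ^ 2 + aθ ^ 2) / lam, D)) (by fun_prop) (by fun_prop) (fun _ _ => trivial)
    (by
      intro D _
      have h : 0 < D ^ 2 + aθ ^ 2 := by positivity
      refine ⟨div_pos (Real.sqrt_pos.2 h) hlam, ?_⟩
      simp only [div_pow, Real.sq_sqrt h.le]
      field_simp
      ring)
    ⟨by
      rintro ⟨r, D⟩ ⟨hr, h⟩
      simp only at hr h
      have : D ^ 2 + aθ ^ 2 = (r * lam) ^ 2 := by linarith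
      refine Prod.ext ?_ rfl
      simp only [this, Real.sqrt_sq (mul_pos hr hlam).le]
      field_simp, fun _ _ => rfl⟩).trans (Homeomorph.Set.univ ℝ)

theorem abs_lt_one_of_mem_unitCircle {q : ℝ × ℝ} (hq : q ∈ unitCircle) {c : ℝ} (hc : c ^ 2 < 1) :
    -1 < c * q.2 ∧ c * q.2 < 1 := by
  simp only [unitCircle, Set.mem_ofPred_eq] at hq
  rw [← abs_lt, ← sq_lt_one_iff_abs_lt_one, mul_pow]
  nlinarith [sq_nonneg q.1, sq_nonneg c, mul_nonneg (sq_nonneg c) (sq_nonneg q.1)]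

/-- In the spherical case the radial curve is a circle. -/
def radialCurveOneHomeomorph {lam aθ κ : ℝ} (hlam : 0 < lam) (haθ : 0 < aθ) (hκ0 : 0 < κ)
    (hκ : κ ^ 2 + aθ ^ 2 = lam ^ 2) : radialCurve 1 lam aθ ≃ₜ unitCircle :=
  have hc : (κ / lam) ^ 2 < 1 := by
    rw [div_pow, div_lt_one (by positivity)]
    have := pow_pos haθ 2
    linarith
  homeomorphOfInvOn
    -- With `y = cos χ = (1 - r²/4)/(1 + r²/4)` one has `1 - y² = r²/(1 + r²/4)²`, so the curve
    -- reads `D² + λ² y² = κ²`; dividing by `κ` gives the unit circle. The inverse is `r = 2 √((1 -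
    -- y)/(1 + y))`, well defined since `κ < λ` keeps `|y| < 1`.
    (fun q : ℝ × ℝ => (q.2 / κ, lam / κ * ((1 - q.1 ^ 2 / 4) / (1 + q.1 ^ 2 / 4))))
    (fun q : ℝ × ℝ => (2 * √((1 - κ / lam * q.2) / (1 + κ / lam * q.2)), κ * q.1))
    (by
      refine Continuous.continuousOn (Continuous.prodMk (by fun_prop) (Continuous.mul (by fun_prop)
        (Continuous.div (by fun_prop) (by fun_prop) fun q => ?_)))
      positivity)
    (by
      refine ContinuousOn.prodMk (ContinuousOn.mul (by fun_prop) (ContinuousOn.sqrt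
        (ContinuousOn.div (by fun_prop) (by fun_prop) fun q hq => ?_))) (by fun_prop)
      linarith [(abs_lt_one_of_mem_unitCircle hq hc).1])
    (by
      rintro ⟨r, D⟩ ⟨hr, h⟩
      simp only at hr h
      simp only [unitCircle, Set.mem_ofPred_eq]
      have hu : 0 < 1 + r ^ 2 / 4 := by positivity
      have e : (D / κ) ^ 2 + (lam / κ * ((1 - r ^ 2 / 4) / (1 + r ^ 2 / 4))) ^ 2 =
          (D ^ 2 * (1 + r ^ 2 / 4) ^ 2 + lam ^ 2 * (1 - r ^ 2 / 4) ^ 2) /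
            (κ ^ 2 * (1 + r ^ 2 / 4) ^ 2) := by
        generalize 1 - r ^ 2 / 4 = v
        generalize 1 + r ^ 2 / 4 = u at hu
        field_simp
      rw [e, div_eq_one_iff_eq (by positivity)]
      linear_combination h - (1 + r ^ 2 / 4) ^ 2 * hκ)
    (by
      intro q hq
      obtain ⟨h1, h2⟩ := abs_lt_one_of_mem_unitCircle hq hc
      have hd : 0 < (1 - κ / lam * q.2) / (1 + κ / lam * q.2) :=
        div_pos (by linarith) (by linarith)
      refine ⟨mul_pos two_pos (Real.sqrt_pos.2 hd), ?_⟩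
      simp only [unitCircle, Set.mem_ofPred_eq] at hq
      simp only [mul_pow, Real.sq_sqrt hd.le]
      obtain ⟨y, hy⟩ : ∃ y, y = κ / lam * q.2 := ⟨_, rfl⟩
      have hy' : lam * y = κ * q.2 := by rw [hy]; field_simp
      rw [← hy] at h1 ⊢
      have h3 : 1 + y ≠ 0 := by linarith
      have e : 1 + 1 * (2 ^ 2 * ((1 - y) / (1 + y))) / 4 = 2 / (1 + y) := by field_simp; ring
      rw [e]
      field_simp
      linear_combination κ ^ 2 * hq + hκ + (lam * y + κ * q.2) * hy')
    ⟨by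
      rintro ⟨r, D⟩ ⟨hr, -⟩
      simp only at hr
      have hu : 0 < 1 + r ^ 2 / 4 := by positivity
      have e : κ / lam * (lam / κ * ((1 - r ^ 2 / 4) / (1 + r ^ 2 / 4))) =
          (1 - r ^ 2 / 4) / (1 + r ^ 2 / 4) := by
        generalize (1 - r ^ 2 / 4) / (1 + r ^ 2 / 4) = y
        field_simp
      have e' : (1 - (1 - r ^ 2 / 4) / (1 + r ^ 2 / 4)) / (1 + (1 - r ^ 2 / 4) / (1 + r ^ 2 / 4)) =
          (r / 2) ^ 2 := by
        have h1 : 1 - (1 - r ^ 2 / 4) / (1 + r ^ 2 / 4) = (r ^ 2 / 2) / (1 + r ^ 2 / 4) := by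
          rw [eq_div_iff hu.ne', sub_mul, div_mul_cancel₀ _ hu.ne']; ring
        have h2 : 1 + (1 - r ^ 2 / 4) / (1 + r ^ 2 / 4) = 2 / (1 + r ^ 2 / 4) := by
          rw [eq_div_iff hu.ne', add_mul, div_mul_cancel₀ _ hu.ne']; ring
        rw [h1, h2, div_div_div_cancel_right₀ hu.ne']
        ring
      refine Prod.ext ?_ ?_
      · simp only [e, e', Real.sqrt_sq (half_pos hr).le]
        ring
      · simp only
        field_simp, by
      intro q hq
      obtain ⟨h1, h2⟩ := abs_lt_one_of_mem_unitCircle hq hc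
      have hd : 0 < (1 - κ / lam * q.2) / (1 + κ / lam * q.2) :=
        div_pos (by linarith) (by linarith)
      have e : (2 * √((1 - κ / lam * q.2) / (1 + κ / lam * q.2))) ^ 2 / 4 =
          (1 - κ / lam * q.2) / (1 + κ / lam * q.2) := by
        rw [mul_pow, Real.sq_sqrt hd.le]; ring
      refine Prod.ext ?_ ?_
      · simp only
        field_simp
      · simp only [e]
        obtain ⟨y, hy⟩ : ∃ y, y = κ / lam * q.2 := ⟨_, rfl⟩
        have hq2 : q.2 = lam / κ * y := by rw [hy]; field_simp
        rw [← hy] at h1 ⊢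
        rw [hq2]
        have h3 : 1 + y ≠ 0 := by linarith
        have e1 : 1 - (1 - y) / (1 + y) = 2 * y / (1 + y) := by field_simp; ring
        have e2 : 1 + (1 - y) / (1 + y) = 2 / (1 + y) := by field_simp; ring
        rw [e1, e2, div_div_div_cancel_right₀ h3]
        ring⟩

/-! ### Range of the radius and connected components. -/

/-- For `k = 1` the endpoints are the roots of `a_θ (1 + r²/4) = r λ`; completing the square turns
the inequality into a bound on the distance of `r` from `2 λ / a_θ`. -/
theorem mem_Icc_rMinus_rPlus {lam aθ r : ℝ} (haθ : 0 < aθ) (hlam : aθ ^ 2 < lam ^ 2) :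
    r ∈ Set.Icc (rMinus 1 lam aθ) (rPlus 1 lam aθ) ↔ aθ * (1 + r ^ 2 / 4) ≤ r * lam := by
  have hA : 1 < (lam / aθ) ^ 2 := by rw [div_pow, one_lt_div (by positivity)]; exact hlam
  have h0 : 0 ≤ (lam / aθ) ^ 2 - 1 := by linarith
  have h1 : aθ * (1 + r ^ 2 / 4) ≤ r * lam ↔
      (r - 2 * (lam / aθ)) ^ 2 ≤ (2 * √((lam / aθ) ^ 2 - 1)) ^ 2 := by
    rw [mul_pow 2, Real.sq_sqrt h0, ← sub_nonneg, ← sub_nonneg (b := (r - 2 * (lam / aθ)) ^ 2)]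
    have : 2 ^ 2 * ((lam / aθ) ^ 2 - 1) - (r - 2 * (lam / aθ)) ^ 2 =
        4 / aθ * (r * lam - aθ * (1 + r ^ 2 / 4)) := by field_simp; ring
    rw [this, mul_nonneg_iff_of_pos_left (by positivity)]
  rw [h1, sq_le_sq, abs_of_nonneg (a := 2 * √((lam / aθ) ^ 2 - 1)) (by positivity), abs_le,
    Set.mem_Icc, rMinus, rPlus]
  constructor <;> rintro ⟨h2, h3⟩ <;> constructor <;> linarith

section

variable {k : ℝ} {b : EReal} {a : ℝ → ℝ} {m lam aθ aφ ρ σ : ℝ}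

/-- A radius occurs exactly when the radial equation can be solved for `D`, that is when `(r λ / (1
+ r²/4))² - a_θ² ≥ 0`; the other parameters are arbitrary. -/
theorem radius_image_branch (hb : 0 < b) (hm : 0 < m) (hlam0 : 0 < lam) (haθ : 0 < aθ)
    (hlam : aθ ^ 2 < lam ^ 2) (hρ : aφ ^ 2 + ρ ^ 2 = aθ ^ 2) (hσ : σ ^ 2 = 1) :
    radius '' branch 1 b a m lam aθ aφ σ = Set.Icc (rMinus 1 lam aθ) (rPlus 1 lam aθ) := by
  ext r
  rw [mem_Icc_rMinus_rPlus haθ hlam]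
  constructor
  · rintro ⟨z, hz, rfl⟩
    obtain ⟨hr, h⟩ := radius_mem_radialCurve haθ hz.1
    simp only [one_mul] at hr h
    rw [← sq_le_sq₀ (by positivity) (by positivity), mul_pow, mul_pow, ← h]
    exact mul_le_mul_of_nonneg_right (by linarith [sq_nonneg (z.1 1 * z.2 1 + z.1 2 * z.2 2 +
      z.1 3 * z.2 3)]) (by positivity)
  · intro h
    have hu : 0 < 1 + r ^ 2 / 4 := by positivity
    have hr : 0 < r := (pos_iff_pos_of_mul_pos ((mul_pos haθ hu).trans_le h)).2 hlam0
    have hD : 0 ≤ (r * lam / (1 + r ^ 2 / 4)) ^ 2 - aθ ^ 2 := by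
      rw [sub_nonneg, sq_le_sq₀ haθ.le (by positivity), le_div_iff₀ hu]
      exact h
    obtain ⟨t, ht⟩ := nonempty_timeInterval hb
    have hq : (t, ((1 : ℝ), (0 : ℝ)), ((1 : ℝ), (0 : ℝ)),
        (r, √((r * lam / (1 + r ^ 2 / 4)) ^ 2 - aθ ^ 2))) ∈ paramSet 1 b lam aθ := by
      refine ⟨ht, by simp [unitCircle], by simp [unitCircle], hr, ?_⟩
      simp only [Real.sq_sqrt hD, one_mul]
      field_simp
      ring
    refine ⟨_, mapsTo_ofParam hm haθ hρ hσ hq, ?_⟩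
    rw [radius, (ofParam_spec haθ hρ hq rfl).1, Real.sqrt_sq hr.le]

theorem nonempty_radialCurve (hlam : 0 < lam) (haθ : 0 < aθ)
    (hk : k = 0 ∨ (k = 1 ∧ aθ ^ 2 < lam ^ 2)) : (radialCurve k lam aθ).Nonempty := by
  rcases hk with rfl | ⟨rfl, hk⟩
  · exact ⟨_, ((radialCurveZeroHomeomorph hlam haθ).symm 0).2⟩
  · have hκ : √(lam ^ 2 - aθ ^ 2) ^ 2 + aθ ^ 2 = lam ^ 2 := by
      rw [Real.sq_sqrt (by linarith)]; ring
    exact ⟨_, ((radialCurveOneHomeomorph hlam haθ (Real.sqrt_pos.2 (by linarith)) hκ).symm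
      (unitCircleHomeomorph.symm 1)).2⟩

/-- The factors of the parameter set. -/
def paramSetHomeomorph {T R : Type*} [TopologicalSpace T] [TopologicalSpace R]
    (e₁ : timeInterval b ≃ₜ T) (e₂ : radialCurve k lam aθ ≃ₜ R) :
    paramSet k b lam aθ ≃ₜ T × Circle × Circle × R :=
  (Homeomorph.Set.prod _ _).trans (e₁.prodCongr ((Homeomorph.Set.prod _ _).trans
    (unitCircleHomeomorph.prodCongr ((Homeomorph.Set.prod _ _).trans
      (unitCircleHomeomorph.prodCongr e₂)))))

theorem nonempty_branch (hb : 0 < b) (hm : 0 < m) (hlam : 0 < lam) (haθ : 0 < aθ)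
    (hk : k = 0 ∨ (k = 1 ∧ aθ ^ 2 < lam ^ 2)) (hρ : aφ ^ 2 + ρ ^ 2 = aθ ^ 2) (hσ : σ ^ 2 = 1) :
    (branch k b a m lam aθ aφ σ).Nonempty := by
  obtain ⟨t, ht⟩ := nonempty_timeInterval hb
  obtain ⟨q, hq⟩ := nonempty_radialCurve hlam haθ hk
  exact ⟨_, mapsTo_ofParam hm haθ hρ hσ (x := (t, (1, 0), (1, 0), q))
    ⟨ht, by simp [unitCircle], by simp [unitCircle], hq⟩⟩

theorem momentum_zero_ne_zero (hm : 0 < m) {z : Phase} (hz : z ∈ levelSet k b a m lam aθ aφ) :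
    z.2 0 ≠ 0 := by
  intro h
  have hp := (mem_levelSet.1 hz).2.1
  rw [h] at hp
  have : 0 < m ^ 2 + (a (z.1 0) ^ 2)⁻¹ * lam ^ 2 := by positivity
  linarith

theorem branch_eq (hm : 0 < m) {z : Phase} (hz : z ∈ branch k b a m lam aθ aφ σ) :
    {w ∈ levelSet k b a m lam aθ aφ | 0 < w.2 0 ↔ 0 < z.2 0} = branch k b a m lam aθ aφ σ := by
  ext w
  refine and_congr_right fun hw => ?_
  have hw0 := momentum_zero_ne_zero hm hw
  have hz' := hz.2
  rcases lt_trichotomy σ 0 with h | h | h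
  · have key (x : ℝ) : 0 < σ * x ↔ x < 0 := by simp [mul_pos_iff, h, h.not_gt]
    have e : z.2 0 < 0 := (key _).1 hz'
    change _ ↔ 0 < σ * w.2 0
    rw [key]
    exact ⟨fun h' => hw0.lt_or_gt.resolve_right fun h'' => lt_asymm e (h'.1 h''),
      fun h' => ⟨fun h'' => absurd h' h''.le.not_gt, fun h'' => absurd e h''.le.not_gt⟩⟩
  · rw [h, zero_mul] at hz'; exact absurd hz' (lt_irrefl 0)
  · change _ ↔ 0 < σ * w.2 0
    rw [mul_pos_iff_of_pos_left h]
    exact iff_of_eq (by simp [(mul_pos_iff_of_pos_left h).1 hz'])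

/-- As `p_t` never vanishes, its sign separates the level set into two relatively open pieces, so a
component cannot leave its branch; the branch is itself preconnected, being an image of `Y`. -/
theorem connectedComponentIn_eq_branch {Y : Type*} [TopologicalSpace Y] [PreconnectedSpace Y]
    (hm : 0 < m) (hσ : σ ≠ 0) (e : branch k b a m lam aθ aφ σ ≃ₜ Y) {z : Phase}
    (hz : z ∈ branch k b a m lam aθ aφ σ) :
    connectedComponentIn (levelSet k b a m lam aθ aφ) z = branch k b a m lam aθ aφ σ := by
  have hc : Continuous fun w : Phase => σ * w.2 0 := by fun_prop
  apply subset_antisymm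
  · have hsub := isPreconnected_connectedComponentIn.subset_left_of_subset_union
      (s := connectedComponentIn (levelSet k b a m lam aθ aφ) z)
      (u := {w : Phase | 0 < σ * w.2 0}) (v := {w : Phase | σ * w.2 0 < 0})
      (isOpen_lt continuous_const hc) (isOpen_lt hc continuous_const)
      (Set.disjoint_left.2 fun w h1 h2 => lt_asymm (show 0 < σ * w.2 0 from h1) h2)
      (fun w hw => (mul_ne_zero hσ (momentum_zero_ne_zero hm
        (connectedComponentIn_subset _ _ hw))).lt_or_gt.symm)
      ⟨z, mem_connectedComponentIn hz.1, hz.2⟩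
    exact fun w hw => ⟨connectedComponentIn_subset _ _ hw, hsub hw⟩
  · refine IsPreconnected.subset_connectedComponentIn ?_ hz fun w hw => hw.1
    have := isPreconnected_range (continuous_subtype_val.comp e.symm.continuous)
    rwa [Set.range_comp, e.symm.range_coe, Set.image_univ, Subtype.range_coe] at this

end

end FRW

end

/-! ### Assembly. -/

theorem mainTheorem3 (k : ℝ) (b : EReal) (a : ℝ → ℝ) (m lam aθ aφ : ℝ)
    (hb : 0 < b)
    (ha : ContDiffOn ℝ ∞ a (FRW.timeInterval b))
    (ha_pos : ∀ t ∈ FRW.timeInterval b, 0 < a t)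
    (hm : 0 < m) (hlam : 0 < lam) (haθ : 0 < aθ) (haφ : aφ ^ 2 < aθ ^ 2)
    (hk : k = 0 ∨ (k = 1 ∧ aθ ^ 2 < lam ^ 2)) :
    -- the level set is non-empty: both signs of `p_t` occur
    (∃ z ∈ FRW.levelSet k b a m lam aθ aφ, 0 < z.2 0) ∧
    (∃ z ∈ FRW.levelSet k b a m lam aθ aφ, z.2 0 < 0) ∧
    -- the four differentials are linearly independent along it
    (∀ z ∈ FRW.levelSet k b a m lam aθ aφ,
      LinearIndependent ℝ (fun i => fderiv ℝ (FRW.F k a i) z)) ∧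
    -- it is a smooth four-dimensional submanifold
    FRW.IsSmoothSubmanifold (FRW.levelSet k b a m lam aθ aφ) ∧
    -- it is invariant under the geodesic flow and the flows of all the integrals
    FRW.IsInvariant b (FRW.hamiltonian k a) (FRW.levelSet k b a m lam aθ aφ) ∧
    (∀ i, FRW.IsInvariant b (FRW.F k a i) (FRW.levelSet k b a m lam aθ aφ)) ∧
    -- its connected components are the two branches given by the sign of `p_t`
    (∀ z ∈ FRW.levelSet k b a m lam aθ aφ, z.2 0 ≠ 0 ∧
      connectedComponentIn (FRW.levelSet k b a m lam aθ aφ) z =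
        {w ∈ FRW.levelSet k b a m lam aθ aφ | 0 < w.2 0 ↔ 0 < z.2 0}) ∧
    -- topology of the components
    (k = 0 → ∀ z ∈ FRW.levelSet k b a m lam aθ aφ,
      Nonempty (connectedComponentIn (FRW.levelSet k b a m lam aθ aφ) z ≃ₜ
        ℝ × ℝ × Circle × Circle)) ∧
    (k = 1 → ∀ z ∈ FRW.levelSet k b a m lam aθ aφ,
      Nonempty (connectedComponentIn (FRW.levelSet k b a m lam aθ aφ) z ≃ₜ
        ℝ × Circle × Circle × Circle) ∧
      FRW.radius '' connectedComponentIn (FRW.levelSet k b a m lam aθ aφ) z =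
        Set.Icc (FRW.rMinus k lam aθ) (FRW.rPlus k lam aθ)) ∧
    -- for the closed universe the level set over all of `(0, b) × S³` is the same set
    (k = 1 → Set.BijOn FRW.toSphere (FRW.levelSet k b a m lam aθ aφ)
      (FRW.sphereLevelSet b a m lam aθ aφ)) := by
  -- The length of the horizontal part of `L`; it is positive because `a_φ² < a_θ²`, so its
  -- direction is defined.
  obtain ⟨ρ, hρ0, hρ⟩ : ∃ ρ, 0 < ρ ∧ aφ ^ 2 + ρ ^ 2 = aθ ^ 2 :=
    ⟨√(aθ ^ 2 - aφ ^ 2), Real.sqrt_pos.2 (by linarith), by rw [Real.sq_sqrt (by linarith)]; ring⟩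
  have hli := fun z hz => FRW.linearIndependent_fderiv_F (m := m) (z := z) ha ha_pos hm hlam haθ haφ
    hk hz
  have hbranch : ∀ z ∈ FRW.levelSet k b a m lam aθ aφ,
      ∃ σ : ℝ, σ ^ 2 = 1 ∧ z ∈ FRW.branch k b a m lam aθ aφ σ := by
    intro z hz
    rcases (FRW.momentum_zero_ne_zero hm hz).lt_or_gt with h | h
    · exact ⟨-1, by norm_num, hz, by linarith⟩
    · exact ⟨1, by norm_num, hz, by linarith⟩
  obtain ⟨eT⟩ := FRW.nonempty_timeInterval_homeomorph hb
  have hzero (σ : ℝ) (hσ : σ ^ 2 = 1) (hk0 : k = 0) :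
      Nonempty (FRW.branch k b a m lam aθ aφ σ ≃ₜ ℝ × ℝ × Circle × Circle) := by
    subst hk0
    exact ⟨(FRW.branchHomeomorph ha.continuousOn ha_pos hm haθ hρ0 hρ hσ).trans
      ((FRW.paramSetHomeomorph eT (FRW.radialCurveZeroHomeomorph hlam haθ)).trans
        -- Moves the radial line in front of the two circles.
        ((Homeomorph.refl ℝ).prodCongr ((Homeomorph.prodAssoc _ _ _).symm.trans
          (Homeomorph.prodComm _ _))))⟩
  have hone (σ : ℝ) (hσ : σ ^ 2 = 1) (hk1 : k = 1) :
      Nonempty (FRW.branch k b a m lam aθ aφ σ ≃ₜ ℝ × Circle × Circle × Circle) := by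
    obtain ⟨rfl, hlt⟩ := hk.resolve_left (by rw [hk1]; exact one_ne_zero)
    have hκ : √(lam ^ 2 - aθ ^ 2) ^ 2 + aθ ^ 2 = lam ^ 2 := by
      rw [Real.sq_sqrt (by linarith)]; ring
    exact ⟨(FRW.branchHomeomorph ha.continuousOn ha_pos hm haθ hρ0 hρ hσ).trans
      (FRW.paramSetHomeomorph eT ((FRW.radialCurveOneHomeomorph hlam haθ
        (Real.sqrt_pos.2 (by linarith)) hκ).trans FRW.unitCircleHomeomorph))⟩
  have hcc (σ : ℝ) (hσ : σ ^ 2 = 1) (z : FRW.Phase) (hz : z ∈ FRW.branch k b a m lam aθ aφ σ) :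
      connectedComponentIn (FRW.levelSet k b a m lam aθ aφ) z =
        FRW.branch k b a m lam aθ aφ σ := by
    have hσ0 : σ ≠ 0 := by rintro rfl; norm_num at hσ
    rcases hk with hk0 | ⟨hk1, -⟩
    · obtain ⟨e⟩ := hzero σ hσ hk0
      exact FRW.connectedComponentIn_eq_branch hm hσ0 e hz
    · obtain ⟨e⟩ := hone σ hσ hk1
      exact FRW.connectedComponentIn_eq_branch hm hσ0 e hz
  refine ⟨?_, ?_, hli, FRW.isSmoothSubmanifold_levelSet ha ha_pos hli, ?_, ?_, ?_, ?_, ?_, ?_⟩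
  · obtain ⟨z, hz, h⟩ := FRW.nonempty_branch (a := a) (σ := 1) hb hm hlam haθ hk hρ (by norm_num)
    exact ⟨z, hz, by linarith⟩
  · obtain ⟨z, hz, h⟩ := FRW.nonempty_branch (a := a) (σ := -1) hb hm hlam haθ hk hρ (by norm_num)
    exact ⟨z, hz, by linarith⟩
  · refine FRW.isInvariant_levelSet ha ha_pos m lam aθ aφ fun z hz j => ?_
    rw [FRW.hamVec_hamiltonian, map_smul, FRW.fderiv_F_hamVec_F ha ha_pos hz, smul_zero]
  · exact fun i => FRW.isInvariant_levelSet ha ha_pos m lam aθ aφ fun z hz j =>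
      FRW.fderiv_F_hamVec_F ha ha_pos hz i j
  · intro z hz
    obtain ⟨σ, hσ, hzσ⟩ := hbranch z hz
    exact ⟨FRW.momentum_zero_ne_zero hm hz, by rw [hcc σ hσ z hzσ, FRW.branch_eq hm hzσ]⟩
  · intro hk0 z hz
    obtain ⟨σ, hσ, hzσ⟩ := hbranch z hz
    rw [hcc σ hσ z hzσ]
    exact hzero σ hσ hk0
  · intro hk1 z hz
    obtain ⟨σ, hσ, hzσ⟩ := hbranch z hz
    rw [hcc σ hσ z hzσ]
    refine ⟨hone σ hσ hk1, ?_⟩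
    obtain ⟨rfl, hlt⟩ := hk.resolve_left (by rw [hk1]; exact one_ne_zero)
    exact FRW.radius_image_branch hb hm hlam haθ hlt hρ hσ
  · rintro rfl
    exact FRW.bijOn_toSphere b a m lam aφ haθ
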